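/- Let $N\ge 1$ be an integer. For $p>N$ and an open set $\Omega\subseteq\mathbb{R}^N$ put $$r_\Omega=\sup\{r>0:\ B_r(x_0)\subseteq\Omega\text{ for some }x_0\in\mathbb{R}^N\}\quad(\sup\emptyset=0),\qquad \lambda_{p,q}(\Omega)=\inf_{u\in C_0^\infty(\Omega)\setminus\{0\}}\frac{\|\nabla u\|_{L^p(\Omega)}^p}{\|u\|_{L^q(\Omega)}^p}\quad(\inf\emptyset=+\infty),$$ and $\lambda_p=\lambda_{p,p}$. Let $B_1\subseteq\mathbb{R}^N$ be the open unit ball centred at the origin, let $\mathrm{Lip}(\overline{B_1})$ be the space of real Lipschitz functions on $\overline{B_1}$, and for $q\in\{p,\infty\}$ set $$\Lambda_{p,q}(B_1\setminus\{0\})=\inf\Big\{\int_{B_1}|\nabla u|^p\,dx:\ u\in\mathrm{Lip}(\overline{B_1}),\ \|u\|_{L^q(B_1)}=1,\ u(0)=0\Big\},\qquad \Lambda_p=\Lambda_{p,p}.$$ Define $$\beta_{N,p}=\max\left\{\frac{\Lambda_p(B_1\setminus\{0\})}{(\sqrt N+1)^p},\ \Big(\frac{p-N}{p}\Big)^p\right\}.$$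 **Theorem.** For every $p>N$ we have $\beta_{N,p}>0$, and for every open set $\Omega\subseteq\mathbb{R}^N$ with finite inradius $r_\Omega<\infty$, $$\lambda_p(\Omega)\ge\frac{\beta_{N,p}}{r_\Omega^p}\qquad\text{and}\qquad \lambda_{p,\infty}(\Omega)\ge\frac{\Lambda_{p,\infty}(B_1\setminus\{0\})}{r_\Omega^{p-N}}.$$ Moreover, $$0<\liminf_{p\searrow N}\frac{\beta_{N,p}}{(p-N)^{p-1}}\le\limsup_{p\searrow N}\frac{\beta_{N,p}}{(p-N)^{p-1}}<+\infty,$$ $$0<\liminf_{p\searrow N}\frac{\Lambda_{p,\infty}(B_1\setminus\{0\})}{(p-N)^{p-1}}\le\limsup_{p\searrow N}\frac{\Lambda_{p,\infty}(B_1\setminus\{0\})}{(p-N)^{p-1}}<+\infty,$$ and $$\lim_{p\to\infty}\big(\beta_{N,p}\big)^{1/p}=\lim_{p\to\infty}\big(\Lambda_{p,\infty}(B_1\setminus\{0\})\big)^{1/p}=1.$$ -/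

import Mathlib

open MeasureTheory Filter Topology
open scoped ENNReal NNReal ContDiff

noncomputable section

/-- The inradius `r_Ω` of `Ω ⊆ ℝ^N`: the supremum, in `[0, ∞]`, of the radii of the open balls
contained in `Ω`. -/
def inradius {N : ℕ} (Ω : Set (EuclideanSpace ℝ (Fin N))) : ℝ≥0∞ :=
  ⨆ (r : ℝ) (_ : 0 < r ∧ ∃ x₀ : EuclideanSpace ℝ (Fin N), Metric.ball x₀ r ⊆ Ω),
    ENNReal.ofReal r

/-- Membership in `C^∞_0(Ω)`: smooth functions with compact support contained in `Ω`
(extended by zero to the whole space). -/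
structure IsTestFunction {N : ℕ} (Ω : Set (EuclideanSpace ℝ (Fin N)))
    (u : EuclideanSpace ℝ (Fin N) → ℝ) : Prop where
  smooth : ContDiff ℝ ∞ u
  hasCompactSupport : HasCompactSupport u
  tsupport_subset : tsupport u ⊆ Ω

/-- The `p`-Dirichlet energy `∫_K |∇u|^p dx`. For `u` Lipschitz on an open set `K` the pointwise
gradient exists at almost every point of `K` (and `gradient` is `0` at the other points). -/
def dirichletEnergy {N : ℕ} (p : ℝ) (K : Set (EuclideanSpace ℝ (Fin N)))
    (u : EuclideanSpace ℝ (Fin N) → ℝ) : ℝ≥0∞ :=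
  ∫⁻ x in K, ‖gradient u x‖ₑ ^ p

/-- The Poincaré–Sobolev constant (generalized principal frequency)
`λ_{p,q}(Ω) = inf { ‖∇u‖_{L^p(Ω)}^p / ‖u‖_{L^q(Ω)}^p : u ∈ C^∞_0(Ω) \ {0} }`,
with values in `[0, ∞]` (it is `∞` when `Ω` is empty). -/
def principalFrequency {N : ℕ} (p : ℝ) (q : ℝ≥0∞) (Ω : Set (EuclideanSpace ℝ (Fin N))) :
    ℝ≥0∞ :=
  ⨅ (u : EuclideanSpace ℝ (Fin N) → ℝ) (_ : IsTestFunction Ω u ∧ u ≠ 0),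
    dirichletEnergy p Ω u / eLpNorm u q (volume.restrict Ω) ^ p

/-- The punctured Poincaré constant
`inf { ∫_K |∇u|^p dx : u ∈ Lip(closure K), ‖u‖_{L^q(K)} = 1, u(x₀) = 0 }`.
For `q = p` this is `Λ_p(K \ {x₀})` and for `q = ∞` it is `Λ_{p,∞}(K \ {x₀})`. -/
def puncturedPoincare {N : ℕ} (p : ℝ) (q : ℝ≥0∞) (K : Set (EuclideanSpace ℝ (Fin N)))
    (x₀ : EuclideanSpace ℝ (Fin N)) : ℝ≥0∞ :=
  ⨅ (u : EuclideanSpace ℝ (Fin N) → ℝ)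
    (_ : (∃ C : ℝ≥0, LipschitzOnWith C u (closure K)) ∧
      eLpNorm u q (volume.restrict K) = 1 ∧ u x₀ = 0),
    dirichletEnergy p K u

/-- `Λ_p(B_1 \ {0})` in dimension `N`. -/
def puncturedBall (N : ℕ) (p : ℝ) : ℝ≥0∞ :=
  puncturedPoincare p (ENNReal.ofReal p) (Metric.ball (0 : EuclideanSpace ℝ (Fin N)) 1) 0

/-- `Λ_{p,∞}(B_1 \ {0})` in dimension `N`. -/
def puncturedBallSup (N : ℕ) (p : ℝ) : ℝ≥0∞ :=
  puncturedPoincare p ⊤ (Metric.ball (0 : EuclideanSpace ℝ (Fin N)) 1) 0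

/-- `β_{N,p} = max { Λ_p(B_1 \ {0}) / (√N + 1)^p, ((p - N) / p)^p }`. -/
def betaConst (N : ℕ) (p : ℝ) : ℝ≥0∞ :=
  max (puncturedBall N p / ENNReal.ofReal ((√(N : ℝ) + 1) ^ p))
    (ENNReal.ofReal (((p - N) / p) ^ p))

end

/-! Everything rests on one inequality. Write a = (p - N)/(p - 1) and k = p a^(p-1). If W is
star-shaped about y and lies within distance R of y, then k ∫_W |u - u(y)|^p ≤ R^p ∫_W |∇u|^p for
Lipschitz u (`lintegral_sub_rpow_le_of_starShaped`). It comes from the fundamental theorem of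
calculus along rays, Hölder with the weight t^(N-1), and the substitution z = y + t(x - y).

Lower bound for λ_p: if R > r_Ω, every point is within R of the complement of Ω. Finitely many
centres outside Ω therefore serve the support of a test function u, and their Voronoi cells, cut at
radius R, are star-shaped about centres where u = 0. Summing over the cells gives λ_p(Ω) ≥ k / r_Ω^p
(`le_principalFrequency`). The two terms of β_{N,p} need no separate geometry: both are at most k
(`betaConst_le`), the first because testing with |x|^a bounds Λ_p(B_1 \ {0}) by (N + p) a^(p-1). For
λ_{p,∞}, a ball of radius R about a point of the complement near a maximum point of |u| is rescaled
to B_1.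

Asymptotics: both constants lie between multiples of a^(p-1). The upper bounds come from |x|^a. The
lower ones come from star-shapedness of B_1 about 0 and, for the sup norm, of a small ball about a
maximum point (`le_puncturedBallSup`). As p ↘ N, a^(p-1) is comparable to (p - N)^(p-1). As p → ∞,
p-th roots remove the remaining factors, provided the radius of the small ball is sent to 0
afterwards. -/

/-! ### Gradients along segments and one-dimensional integrals -/

section Gradient

variable {F : Type*} [NormedAddCommGroup F] [InnerProductSpace ℝ F] [CompleteSpace F]

theorem enorm_gradient (u : F → ℝ) (x : F) : ‖gradient u x‖ₑ = ‖fderiv ℝ u x‖ₑ := by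
  rw [gradient, ← ofReal_norm, ← ofReal_norm, LinearIsometryEquiv.norm_map]

theorem measurable_enorm_gradient [MeasurableSpace F] [OpensMeasurableSpace F] (u : F → ℝ) :
    Measurable fun x => ‖gradient u x‖ₑ := by
  simp only [enorm_gradient]
  exact (measurable_fderiv ℝ u).enorm

/-- A Lipschitz function is absolutely continuous along a segment, so differentiability at almost
every parameter is enough for the fundamental theorem of calculus and the chain rule. -/
theorem enorm_sub_le_lintegral_gradient {K : ℝ≥0} {u : F → ℝ} (hu : LipschitzWith K u) (y x : F)
    (h : ∀ᵐ t ∂(volume.restrict (Set.Ioc (0 : ℝ) 1)), DifferentiableAt ℝ u (y + t • (x - y))) :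
    ‖u x - u y‖ₑ ≤
      ‖x - y‖ₑ * ∫⁻ t in Set.Ioc (0 : ℝ) 1, ‖gradient u (y + t • (x - y))‖ₑ := by
  set g : ℝ → ℝ := fun t => u (y + t • (x - y)) with hg
  have hline : LipschitzWith ‖x - y‖₊ fun t : ℝ => y + t • (x - y) := by
    refine LipschitzWith.of_dist_le_mul fun s t => ?_
    rw [dist_add_left, dist_eq_norm, ← sub_smul, norm_smul, mul_comm, Real.dist_eq]
    rfl
  have hgl : LipschitzWith (K * ‖x - y‖₊) g := hu.comp hline
  have hint := (hgl.lipschitzOnWith (s := Set.uIcc (0 : ℝ) 1)).absolutelyContinuousOnInterval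
    |>.integral_deriv_eq_sub
  have h1 : u x - u y = ∫ t in (0 : ℝ)..1, deriv g t := by
    rw [hint]; simp [hg]
  rw [h1, intervalIntegral.integral_of_le zero_le_one]
  refine (enorm_integral_le_lintegral_enorm _).trans ?_
  rw [← lintegral_const_mul' _ _ enorm_ne_top]
  refine lintegral_mono_ae ?_
  filter_upwards [h] with t ht
  have hd : HasDerivAt (fun t : ℝ => y + t • (x - y)) (x - y) t := by
    simpa using ((hasDerivAt_id t).smul_const (x - y)).const_add y
  have := (ht.hasFDerivAt.comp_hasDerivAt t hd).deriv
  change deriv g t = _ at this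
  rw [this, enorm_gradient, mul_comm]
  exact ContinuousLinearMap.le_opENorm _ _

end Gradient

theorem lintegral_comp_add_smul {N : ℕ} (y : EuclideanSpace ℝ (Fin N)) {t : ℝ} (ht : 0 < t)
    (f : EuclideanSpace ℝ (Fin N) → ℝ≥0∞) :
    ∫⁻ x, f (y + t • x) = ENNReal.ofReal ((t ^ N)⁻¹) * ∫⁻ z, f z := by
  have h2 : ∫⁻ z, f z = ∫⁻ z, f (y + z) := (lintegral_add_left_eq_self f y).symm
  have h3 := Measure.map_addHaar_smul
    (volume : Measure (EuclideanSpace ℝ (Fin N))) ht.ne'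
  have h4 := lintegral_map_equiv (μ := (volume : Measure (EuclideanSpace ℝ (Fin N))))
    (fun z => f (y + z)) (Homeomorph.smulOfNeZero t ht.ne').toMeasurableEquiv
  have h5 : ⇑(Homeomorph.smulOfNeZero (α := EuclideanSpace ℝ (Fin N)) t ht.ne').toMeasurableEquiv
      = fun x => t • x := rfl
  rw [h5, h3, lintegral_smul_measure] at h4
  rw [h2, ← h4, finrank_euclideanSpace_fin, abs_of_pos (by positivity), smul_eq_mul]

theorem lintegral_comp_homothety {N : ℕ} (y : EuclideanSpace ℝ (Fin N)) {t : ℝ} (ht : 0 < t)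
    (f : EuclideanSpace ℝ (Fin N) → ℝ≥0∞) :
    ∫⁻ x, f (y + t • (x - y)) = ENNReal.ofReal ((t ^ N)⁻¹) * ∫⁻ z, f z :=
  (lintegral_sub_right_eq_self (fun x => f (y + t • x)) y).trans (lintegral_comp_add_smul y ht f)

theorem lintegral_Ioc_rpow {r : ℝ} (hr : -1 < r) :
    ∫⁻ t in Set.Ioc (0 : ℝ) 1, ENNReal.ofReal (t ^ r) = ENNReal.ofReal (1 / (r + 1)) := by
  rw [← ofReal_integral_eq_lintegral_ofReal]
  · rw [← intervalIntegral.integral_of_le zero_le_one, integral_rpow (Or.inl hr)]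
    rw [Real.one_rpow, Real.zero_rpow (by linarith), sub_zero]
  · exact (intervalIntegrable_iff_integrableOn_Ioc_of_le zero_le_one).1
      (intervalIntegral.intervalIntegrable_rpow' hr)
  · filter_upwards [ae_restrict_mem measurableSet_Ioc] with t ht
    exact Real.rpow_nonneg ht.1.le _

/-- Hölder applied to G = (t^(m/p) G) · t^(-m/p). The dual factor is ∫ t^(-m/(p-1)) = (p-1)/(p-1-m),
finite exactly because m + 1 < p. With m = N - 1 this is where p > N enters. -/
theorem rpow_lintegral_Ioc_le {m p : ℝ} (hm : 0 ≤ m) (hp : m + 1 < p) {G : ℝ → ℝ≥0∞}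
    (hG : AEMeasurable G (volume.restrict (Set.Ioc (0 : ℝ) 1))) :
    (∫⁻ t in Set.Ioc (0 : ℝ) 1, G t) ^ p ≤
      ENNReal.ofReal (((p - 1) / (p - 1 - m)) ^ (p - 1)) *
        ∫⁻ t in Set.Ioc (0 : ℝ) 1, ENNReal.ofReal (t ^ m) * G t ^ p := by
  have hp1 : 1 < p := by linarith
  have hp0 : 0 < p := by linarith
  have hq : p.HolderConjugate (p / (p - 1)) := Real.HolderConjugate.conjExponent hp1
  have key := ENNReal.lintegral_mul_le_Lp_mul_Lq (volume.restrict (Set.Ioc (0 : ℝ) 1)) hq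
    (f := fun t => ENNReal.ofReal (t ^ (m / p)) * G t)
    (g := fun t => ENNReal.ofReal (t ^ (-(m / p)))) (by fun_prop) (by fun_prop)
  have e1 : ∫⁻ t in Set.Ioc (0 : ℝ) 1, G t = ∫⁻ t in Set.Ioc (0 : ℝ) 1,
      ((fun t => ENNReal.ofReal (t ^ (m / p)) * G t) *
        fun t => ENNReal.ofReal (t ^ (-(m / p)))) t := by
    refine setLIntegral_congr_fun measurableSet_Ioc fun t ht => ?_
    simp only [Pi.mul_apply]
    rw [mul_right_comm, ← ENNReal.ofReal_mul (Real.rpow_nonneg ht.1.le _),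
      ← Real.rpow_add ht.1, add_neg_cancel, Real.rpow_zero, ENNReal.ofReal_one, one_mul]
  have e2 : ∫⁻ t in Set.Ioc (0 : ℝ) 1, (ENNReal.ofReal (t ^ (m / p)) * G t) ^ p =
      ∫⁻ t in Set.Ioc (0 : ℝ) 1, ENNReal.ofReal (t ^ m) * G t ^ p := by
    refine setLIntegral_congr_fun measurableSet_Ioc fun t ht => ?_
    rw [ENNReal.mul_rpow_of_nonneg _ _ hp0.le,
      ENNReal.ofReal_rpow_of_nonneg (Real.rpow_nonneg ht.1.le _) hp0.le, ← Real.rpow_mul ht.1.le,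
      div_mul_cancel₀ _ hp0.ne']
  have e3 : ∫⁻ t in Set.Ioc (0 : ℝ) 1, ENNReal.ofReal (t ^ (-(m / p))) ^ (p / (p - 1)) =
      ENNReal.ofReal ((p - 1) / (p - 1 - m)) := by
    have : ∀ t ∈ Set.Ioc (0 : ℝ) 1, ENNReal.ofReal (t ^ (-(m / p))) ^ (p / (p - 1)) =
        ENNReal.ofReal (t ^ (-(m / (p - 1)))) := fun t ht => by
      rw [ENNReal.ofReal_rpow_of_nonneg (Real.rpow_nonneg ht.1.le _) (by
        apply div_nonneg <;> linarith), ← Real.rpow_mul ht.1.le]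
      congr 2
      have : p - 1 ≠ 0 := by linarith
      field_simp
    rw [setLIntegral_congr_fun measurableSet_Ioc this, lintegral_Ioc_rpow]
    · congr 1
      have : p - 1 ≠ 0 := by linarith
      have : p - 1 - m ≠ 0 := by linarith
      have : -(m / (p - 1)) + 1 = (p - 1 - m) / (p - 1) := by field_simp; ring
      rw [this, one_div_div]
    · rw [neg_lt_neg_iff, div_lt_one] <;> linarith
  rw [e2, e3, ← e1] at key
  calc _ ≤ _ := ENNReal.rpow_le_rpow key hp0.le
    _ = _ := by
      rw [ENNReal.mul_rpow_of_nonneg _ _ hp0.le, ← ENNReal.rpow_mul, ← ENNReal.rpow_mul,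
        one_div_mul_cancel hp0.ne', ENNReal.rpow_one, mul_comm, one_div_div,
        div_mul_cancel₀ _ hp0.ne', ENNReal.ofReal_rpow_of_nonneg _ (by linarith)]
      apply div_nonneg <;> linarith

theorem lintegral_Ici_rpow {c p : ℝ} (hc : 0 < c) (hp : 0 < p) :
    ∫⁻ t in Set.Ici c, ENNReal.ofReal (t ^ (-1 - p)) = ENNReal.ofReal (c ^ (-p) / p) := by
  rw [← restrict_Ioi_eq_restrict_Ici, ← ofReal_integral_eq_lintegral_ofReal]
  · rw [integral_Ioi_rpow_of_lt (by linarith) hc]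
    congr 1
    rw [show -1 - p + 1 = -p by ring, neg_div_neg_eq]
  · exact integrableOn_Ioi_rpow_of_lt (by linarith) hc
  · filter_upwards [ae_restrict_mem measurableSet_Ioi] with t ht
    exact Real.rpow_nonneg (hc.trans ht).le _

/-! ### Poincaré inequality on star-shaped sets -/

/-- By Rademacher the bad set is null, and for each t > 0 so is its preimage under the homothety of
ratio t. Fubini exchanges the two quantifiers. -/
theorem ae_ae_differentiableAt_homothety {N : ℕ} {K : ℝ≥0} {u : EuclideanSpace ℝ (Fin N) → ℝ}
    (hu : LipschitzWith K u) (y : EuclideanSpace ℝ (Fin N)) :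
    ∀ᵐ x : EuclideanSpace ℝ (Fin N), ∀ᵐ t ∂(volume.restrict (Set.Ioc (0 : ℝ) 1)),
      DifferentiableAt ℝ u (y + t • (x - y)) := by
  have hD : MeasurableSet {z | ¬ DifferentiableAt ℝ u z} :=
    (measurableSet_of_differentiableAt ℝ u).compl
  have hnull : volume {z | ¬ DifferentiableAt ℝ u z} = 0 :=
    hu.ae_differentiableAt (μ := (volume : Measure (EuclideanSpace ℝ (Fin N))))
  rw [Measure.ae_ae_comm]
  · filter_upwards [ae_restrict_mem measurableSet_Ioc] with t ht
    have h := lintegral_comp_homothety y ht.1 (Set.indicator {z | ¬ DifferentiableAt ℝ u z} 1)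
    rw [lintegral_indicator_one hD, hnull, mul_zero] at h
    have hm : Measurable fun x : EuclideanSpace ℝ (Fin N) => y + t • (x - y) := by fun_prop
    have h2 : (fun x => Set.indicator {z | ¬ DifferentiableAt ℝ u z} (1 : EuclideanSpace ℝ (Fin N) → ℝ≥0∞)
        (y + t • (x - y))) = Set.indicator {x | ¬ DifferentiableAt ℝ u (y + t • (x - y))} 1 := by
      ext x; simp [Set.indicator]
    rw [h2] at h
    exact (lintegral_indicator_one (μ := volume) (hm hD)).symm.trans h
  · have hm : Measurable fun z : EuclideanSpace ℝ (Fin N) × ℝ => y + z.2 • (z.1 - y) := by fun_prop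
    exact hm (measurableSet_of_differentiableAt ℝ u)

/-- Poincaré inequality on sets that are star-shaped about `y`, for functions vanishing at `y`. -/
theorem lintegral_sub_rpow_le_of_starShaped {N : ℕ} (hN : 1 ≤ N) {p : ℝ} (hp : (N : ℝ) < p)
    {K : ℝ≥0} {u : EuclideanSpace ℝ (Fin N) → ℝ} (hu : LipschitzWith K u)
    {y : EuclideanSpace ℝ (Fin N)} {R : ℝ} {W : Set (EuclideanSpace ℝ (Fin N))}
    (hW : MeasurableSet W)
    (hstar : ∀ x ∈ W, ∀ t ∈ Set.Ioc (0 : ℝ) 1, y + t • (x - y) ∈ W)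
    (hWR : ∀ x ∈ W, ‖x - y‖ ≤ R) :
    ∫⁻ x in W, ‖u x - u y‖ₑ ^ p ≤
      ENNReal.ofReal (((p - 1) / (p - N)) ^ (p - 1) / p * R ^ p) *
        ∫⁻ x in W, ‖gradient u x‖ₑ ^ p := by
  have hN' : (1 : ℝ) ≤ N := by exact_mod_cast hN
  have hp0 : 0 < p := by linarith
  rcases W.eq_empty_or_nonempty with rfl | ⟨w, hw⟩
  · simp
  have hR0 : 0 ≤ R := (norm_nonneg _).trans (hWR w hw)
  set G : EuclideanSpace ℝ (Fin N) → ℝ≥0∞ := fun x => ‖gradient u x‖ₑ with hG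
  have hGm : Measurable G := measurable_enorm_gradient u
  have hmap : Measurable fun z : EuclideanSpace ℝ (Fin N) × ℝ => y + z.2 • (z.1 - y) := by fun_prop
  set A : ℝ≥0∞ := ENNReal.ofReal (((p - 1) / (p - N)) ^ (p - 1)) with hA
  -- pointwise bound along rays
  have h1 : ∀ᵐ x : EuclideanSpace ℝ (Fin N), ‖u x - u y‖ₑ ^ p ≤
      A * ∫⁻ t in Set.Ioc (0 : ℝ) 1,
        ‖x - y‖ₑ ^ p * (ENNReal.ofReal (t ^ ((N : ℝ) - 1)) * G (y + t • (x - y)) ^ p) := by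
    filter_upwards [ae_ae_differentiableAt_homothety hu y] with x hx
    have hmx : Measurable fun t : ℝ => y + t • (x - y) := by fun_prop
    have h := rpow_lintegral_Ioc_le (m := (N : ℝ) - 1) (p := p) (by linarith) (by linarith)
      (G := fun t => G (y + t • (x - y))) (hGm.comp hmx).aemeasurable
    rw [show p - 1 - ((N : ℝ) - 1) = p - N by ring] at h
    calc _ ≤ _ := ENNReal.rpow_le_rpow (enorm_sub_le_lintegral_gradient hu y x hx) hp0.le
      _ ≤ _ := by
        rw [ENNReal.mul_rpow_of_nonneg _ _ hp0.le,
          lintegral_const_mul' _ _ (ENNReal.rpow_ne_top_of_nonneg hp0.le enorm_ne_top),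
          mul_left_comm]
        gcongr
  -- the substituted integrand
  set B : ℝ → EuclideanSpace ℝ (Fin N) → ℝ≥0∞ := fun t z =>
    Set.indicator W (fun z => ‖z - y‖ₑ ^ p * G z ^ p *
      Set.indicator (Set.Ici (‖z - y‖ / R)) (fun t => ENNReal.ofReal (t ^ (-1 - p))) t) z with hB
  -- Substituting z = y + t(x - y) turns ‖x - y‖^p into t^(-p) ‖z - y‖^p and costs t^(-N), so the
  -- weight t^(N-1) becomes t^(-1-p). Star-shapedness keeps z in W.
  have h2 : ∀ t ∈ Set.Ioc (0 : ℝ) 1, ∫⁻ x in W,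
      ‖x - y‖ₑ ^ p * (ENNReal.ofReal (t ^ ((N : ℝ) - 1)) * G (y + t • (x - y)) ^ p) ≤
      ∫⁻ z, B t z := by
    intro t ht
    have hsub : ∀ x ∈ W,
        ‖x - y‖ₑ ^ p * (ENNReal.ofReal (t ^ ((N : ℝ) - 1)) * G (y + t • (x - y)) ^ p) ≤
        ENNReal.ofReal (t ^ N) * B t (y + t • (x - y)) := by
      intro x hx
      have hnorm : ‖y + t • (x - y) - y‖ = t * ‖x - y‖ := by
        rw [add_sub_cancel_left, norm_smul, Real.norm_of_nonneg ht.1.le]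
      have henorm : ‖y + t • (x - y) - y‖ₑ = ENNReal.ofReal t * ‖x - y‖ₑ := by
        rw [← ofReal_norm, hnorm, ENNReal.ofReal_mul ht.1.le, ofReal_norm]
      -- In terms of z, the constraint ‖x - y‖ ≤ R reads t ≥ ‖z - y‖ / R; this keeps the singular
      -- weight integrable.
      have hmem : t ∈ Set.Ici (‖y + t • (x - y) - y‖ / R) := by
        rw [Set.mem_Ici, hnorm]
        exact div_le_of_le_mul₀ hR0 ht.1.le (mul_le_mul_of_nonneg_left (hWR x hx) ht.1.le)
      simp only [hB]
      rw [Set.indicator_of_mem (hstar x hx t ht), Set.indicator_of_mem hmem, henorm,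
        ENNReal.mul_rpow_of_nonneg _ _ hp0.le, ENNReal.ofReal_rpow_of_pos ht.1]
      have : ENNReal.ofReal (t ^ ((N : ℝ) - 1)) =
          ENNReal.ofReal (t ^ N) * ENNReal.ofReal (t ^ p) * ENNReal.ofReal (t ^ (-1 - p)) := by
        rw [← ENNReal.ofReal_mul (by positivity [ht.1]), ← ENNReal.ofReal_mul (by positivity [ht.1]),
          ← Real.rpow_natCast, ← Real.rpow_add ht.1, ← Real.rpow_add ht.1]
        congr 2; ring
      rw [this]
      apply le_of_eq
      ring
    calc _ ≤ ∫⁻ x in W, ENNReal.ofReal (t ^ N) * B t (y + t • (x - y)) :=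
          setLIntegral_mono' hW hsub
      _ ≤ ∫⁻ x, ENNReal.ofReal (t ^ N) * B t (y + t • (x - y)) := setLIntegral_le_lintegral _ _
      _ = ∫⁻ z, B t z := by
          rw [lintegral_const_mul' _ _ ENNReal.ofReal_ne_top, lintegral_comp_homothety y ht.1,
            ← mul_assoc, ← ENNReal.ofReal_mul (by positivity [ht.1]),
            mul_inv_cancel₀ (pow_pos ht.1 N).ne', ENNReal.ofReal_one, one_mul]
  have hBm : Measurable (Function.uncurry B) := by
    have : Function.uncurry B = fun q : ℝ × EuclideanSpace ℝ (Fin N) =>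
        Set.indicator {q : ℝ × EuclideanSpace ℝ (Fin N) | q.2 ∈ W ∧ ‖q.2 - y‖ / R ≤ q.1}
        (fun q => ‖q.2 - y‖ₑ ^ p * G q.2 ^ p * ENNReal.ofReal (q.1 ^ (-1 - p))) q := by
      ext ⟨t, z⟩
      by_cases hz : z ∈ W <;> by_cases ht : ‖z - y‖ / R ≤ t <;>
        simp [Function.uncurry, hB, Set.indicator, hz, ht]
    rw [this]
    refine Measurable.indicator (by fun_prop) (MeasurableSet.inter (measurable_snd hW) ?_)
    exact measurableSet_le (f := fun q : ℝ × EuclideanSpace ℝ (Fin N) => ‖q.2 - y‖ / R)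
      (by fun_prop) measurable_fst
  -- Integrating t^(-1-p) from ‖z - y‖/R to infinity gives R^p / (p ‖z - y‖^p), which cancels the
  -- factor ‖z - y‖^p exactly.
  have h3 : ∀ z, ∫⁻ t in Set.Ioc (0 : ℝ) 1, B t z ≤
      Set.indicator W (fun z => ENNReal.ofReal (R ^ p / p) * G z ^ p) z := by
    intro z
    by_cases hz : z ∈ W
    · simp only [hB, Set.indicator_of_mem hz]
      rcases eq_or_ne z y with rfl | hzy
      · simp [hp0]
      have hd : 0 < ‖z - y‖ := norm_pos_iff.2 (sub_ne_zero.2 hzy)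
      have hR : 0 < R := hd.trans_le (hWR z hz)
      have hc : 0 < ‖z - y‖ / R := div_pos hd hR
      rw [lintegral_const_mul _ (Measurable.indicator (by fun_prop) measurableSet_Ici)]
      calc _ ≤ ‖z - y‖ₑ ^ p * G z ^ p * ENNReal.ofReal ((‖z - y‖ / R) ^ (-p) / p) := by
            gcongr
            rw [← lintegral_Ici_rpow hc hp0, ← lintegral_indicator measurableSet_Ici]
            exact setLIntegral_le_lintegral _ _
        _ = _ := by
            rw [← ofReal_norm, ENNReal.ofReal_rpow_of_pos hd, mul_right_comm,
              ← ENNReal.ofReal_mul (by positivity)]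
            congr 2
            rw [Real.rpow_neg hc.le, Real.div_rpow hd.le hR.le]
            have := Real.rpow_pos_of_pos hd p
            have := Real.rpow_pos_of_pos hR p
            field_simp
    · simp [hB, hz]
  calc ∫⁻ x in W, ‖u x - u y‖ₑ ^ p
      ≤ ∫⁻ x in W, A * ∫⁻ t in Set.Ioc (0 : ℝ) 1,
        ‖x - y‖ₑ ^ p * (ENNReal.ofReal (t ^ ((N : ℝ) - 1)) * G (y + t • (x - y)) ^ p) :=
        lintegral_mono_ae (ae_restrict_of_ae h1)
    _ = A * ∫⁻ t in Set.Ioc (0 : ℝ) 1, ∫⁻ x in W,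
        ‖x - y‖ₑ ^ p * (ENNReal.ofReal (t ^ ((N : ℝ) - 1)) * G (y + t • (x - y)) ^ p) := by
        rw [lintegral_const_mul' _ _ ENNReal.ofReal_ne_top, lintegral_lintegral_swap]
        have := hGm.comp hmap
        simp only [Function.comp_def] at this
        apply Measurable.aemeasurable
        simp only [Function.uncurry_def]
        fun_prop
    _ ≤ A * ∫⁻ t in Set.Ioc (0 : ℝ) 1, ∫⁻ z, B t z := by
        gcongr 1
        exact setLIntegral_mono' measurableSet_Ioc h2
    _ = A * ∫⁻ z, ∫⁻ t in Set.Ioc (0 : ℝ) 1, B t z := by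
        rw [lintegral_lintegral_swap hBm.aemeasurable]
    _ ≤ A * ∫⁻ z, Set.indicator W (fun z => ENNReal.ofReal (R ^ p / p) * G z ^ p) z := by
        gcongr 1
        exact lintegral_mono h3
    _ = _ := by
        rw [lintegral_indicator hW, lintegral_const_mul' _ _ ENNReal.ofReal_ne_top, ← mul_assoc, hA,
          ← ENNReal.ofReal_mul (Real.rpow_nonneg (div_nonneg (by linarith) (by linarith)) _)]
        congr 2
        ring

/-! ### Inradius, Voronoi cells and the lower bound for λ_p -/

theorem exists_notMem_dist_lt_of_inradius_lt {N : ℕ} {Ω : Set (EuclideanSpace ℝ (Fin N))} {R : ℝ}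
    (hR : 0 < R) (h : inradius Ω < ENNReal.ofReal R) (x : EuclideanSpace ℝ (Fin N)) :
    ∃ c ∉ Ω, dist c x < R := by
  by_contra! hc
  refine h.not_ge ?_
  refine le_iSup₂_of_le (f := fun (r : ℝ) _ => ENNReal.ofReal r) R ⟨hR, x, fun c hcx => ?_⟩ le_rfl
  by_contra hcΩ
  exact (hc c hcΩ).not_gt hcx

/-- Estimates are proved for radii R strictly above the inradius, where the complement is within
distance R of every point; letting R decrease to ρ recovers the inradius, including ρ = 0. -/
theorem div_rpow_le_of_forall_gt {X Y ρ : ℝ≥0∞} {s : ℝ} (hs : 0 < s) (hρ : ρ < ⊤)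
    (h : ∀ R : ℝ, 0 < R → ρ < ENNReal.ofReal R → X / ENNReal.ofReal R ^ s ≤ Y) :
    X / ρ ^ s ≤ Y := by
  obtain ⟨r, hr0, rfl⟩ : ∃ r : ℝ, 0 ≤ r ∧ ENNReal.ofReal r = ρ :=
    ⟨ρ.toReal, ENNReal.toReal_nonneg, ENNReal.ofReal_toReal hρ.ne⟩
  have ht : Tendsto (fun R : ℝ => X / ENNReal.ofReal R ^ s) (𝓝[>] r)
      (𝓝 (X / ENNReal.ofReal r ^ s)) := by
    refine ENNReal.Tendsto.const_div ?_ (Or.inl (ENNReal.rpow_ne_top_of_nonneg hs.le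
      ENNReal.ofReal_ne_top))
    exact ((ENNReal.continuous_rpow_const.comp ENNReal.continuous_ofReal).tendsto r).mono_left
      nhdsWithin_le_nhds
  refine le_of_tendsto ht ?_
  filter_upwards [self_mem_nhdsWithin] with R hR
  have hR0 : 0 < R := hr0.trans_lt hR
  exact h R hR0 ((ENNReal.ofReal_lt_ofReal_iff hR0).2 hR)

namespace IsTestFunction

variable {N : ℕ} {Ω : Set (EuclideanSpace ℝ (Fin N))} {u : EuclideanSpace ℝ (Fin N) → ℝ}

theorem apply_eq_zero (hu : IsTestFunction Ω u) {x : EuclideanSpace ℝ (Fin N)} (hx : x ∉ Ω) :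
    u x = 0 :=
  image_eq_zero_of_notMem_tsupport fun h => hx (hu.tsupport_subset h)

theorem gradient_eq_zero (hu : IsTestFunction Ω u) {x : EuclideanSpace ℝ (Fin N)} (hx : x ∉ Ω) :
    gradient u x = 0 := by
  rw [gradient, fderiv_of_notMem_tsupport (𝕜 := ℝ) fun h => hx (hu.tsupport_subset h), map_zero]

theorem exists_lipschitzWith (hu : IsTestFunction Ω u) : ∃ K, LipschitzWith K u :=
  ⟨_, (hu.smooth.lipschitzWith_of_hasCompactSupport hu.hasCompactSupport (by simp)).choose_spec⟩

theorem lintegral_gradient_le_dirichletEnergy (hu : IsTestFunction Ω u) {p : ℝ} (hp : 0 < p) :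
    ∫⁻ x, ‖gradient u x‖ₑ ^ p ≤ dirichletEnergy p Ω u := by
  have : (fun x => ‖gradient u x‖ₑ ^ p) = Ω.indicator fun x => ‖gradient u x‖ₑ ^ p := by
    ext x
    by_cases hx : x ∈ Ω
    · simp [hx]
    · simp [hx, hu.gradient_eq_zero hx, hp]
  rw [this]
  exact lintegral_indicator_le _ _

theorem exists_forall_abs_le (hu : IsTestFunction Ω u) (h0 : u ≠ 0) : ∃ x, u x ≠ 0 ∧ ∀ z, |u z| ≤ |u x| := by
  obtain ⟨w, hw⟩ := Function.ne_iff.1 h0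
  obtain ⟨x, hx⟩ := (hu.smooth.continuous.abs).exists_forall_ge_of_hasCompactSupport
    (hu.hasCompactSupport.comp_left (g := fun t : ℝ => |t|) abs_zero)
  refine ⟨x, fun h => hw ?_, hx⟩
  have := hx w
  rw [h, abs_zero] at this
  exact abs_eq_zero.1 (le_antisymm this (abs_nonneg _))

/-- Poincaré inequality obtained by summing the inequalities on truncated Voronoi cells centred
outside `Ω`. -/
theorem lintegral_rpow_le (hu : IsTestFunction Ω u) (hN : 1 ≤ N) {p : ℝ} (hp : (N : ℝ) < p)
    {R : ℝ} (hΩ : ∀ x : EuclideanSpace ℝ (Fin N), ∃ c ∉ Ω, dist c x < R) :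
    ∫⁻ x, ‖u x‖ₑ ^ p ≤
      ENNReal.ofReal (((p - 1) / (p - N)) ^ (p - 1) / p * R ^ p) * dirichletEnergy p Ω u := by
  have hp0 : 0 < p := (Nat.cast_nonneg N).trans_lt hp
  obtain ⟨K, hK⟩ := hu.exists_lipschitzWith
  -- Compactness of the support leaves finitely many centres, all outside Ω, so that u vanishes at
  -- each of them.
  obtain ⟨s, hs⟩ := hu.hasCompactSupport.elim_finite_subcover
    (fun c : ↥Ωᶜ => Metric.ball (c : EuclideanSpace ℝ (Fin N)) R) (fun _ => Metric.isOpen_ball)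
    (fun x _ => by
      obtain ⟨c, hc, hcx⟩ := hΩ x
      exact Set.mem_iUnion.2 ⟨⟨c, hc⟩, by rwa [Metric.mem_ball, dist_comm]⟩)
  let e := s.equivFin.symm
  let c : Fin s.card → EuclideanSpace ℝ (Fin N) := fun i => ((e i : ↥Ωᶜ) : EuclideanSpace ℝ (Fin N))
  have hcΩ : ∀ i, c i ∉ Ω := fun i => (e i : ↥Ωᶜ).2
  have hcover : ∀ x ∈ tsupport u, ∃ i, dist x (c i) < R := by
    intro x hx
    obtain ⟨d, hd, hxd⟩ := Set.mem_iUnion₂.1 (hs hx)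
    exact ⟨s.equivFin ⟨d, hd⟩, by simpa [c, e] using hxd⟩
  -- Ties between nearest centres go to the smallest index, which makes the cells disjoint.
  let V : Fin s.card → Set (EuclideanSpace ℝ (Fin N)) := fun i =>
    {x | dist x (c i) < R ∧ ∀ j, dist x (c i) ≤ dist x (c j) ∧
      (j < i → dist x (c i) < dist x (c j))}
  have hVm : ∀ i, MeasurableSet (V i) := by
    intro i
    have : V i = Metric.ball (c i) R ∩ ⋂ j, ({x | dist x (c i) ≤ dist x (c j)} ∩
        {x | j < i → dist x (c i) < dist x (c j)}) := by
      ext x; simp [V]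
    rw [this]
    refine measurableSet_ball.inter (MeasurableSet.iInter fun j => MeasurableSet.inter ?_ ?_)
    · exact measurableSet_le (by fun_prop) (by fun_prop)
    · by_cases hji : j < i
      · simp only [hji, forall_const]
        exact measurableSet_lt (by fun_prop) (by fun_prop)
      · simp [hji]
  have hVdisj : Pairwise (Function.onFun Disjoint V) := by
    have key : ∀ i j, i < j → Disjoint (V i) (V j) := fun i j hij =>
      Set.disjoint_left.2 fun x hi hj => ((hj.2 i).2 hij).not_ge (hi.2 j).1
    intro i j hij
    rcases lt_or_gt_of_ne hij with h | h
    · exact key i j h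
    · exact (key j i h).symm
  have hVcover : ∀ x ∈ tsupport u, x ∈ ⋃ i, V i := by
    intro x hx
    obtain ⟨i₀, hi₀⟩ := hcover x hx
    -- The lexicographic minimum of (distance, index) is the nearest centre with ties broken as in
    -- `V`.
    obtain ⟨i, -, hi⟩ := Finset.exists_min_image Finset.univ
      (fun i : Fin s.card => toLex (dist x (c i), i)) ⟨i₀, Finset.mem_univ _⟩
    have hi' : ∀ j, dist x (c i) < dist x (c j) ∨ dist x (c i) = dist x (c j) ∧ i ≤ j := fun j =>
      Prod.Lex.toLex_le_toLex.1 (hi j (Finset.mem_univ _))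
    have hle : ∀ j, dist x (c i) ≤ dist x (c j) := fun j =>
      (hi' j).elim le_of_lt fun h => h.1.le
    exact Set.mem_iUnion.2 ⟨i, (hle i₀).trans_lt hi₀, fun j => ⟨hle j, fun hji =>
      (hi' j).elim id fun h => absurd hji h.2.not_gt⟩⟩
  -- Moving x towards its centre by (1 - t) d(x, c_i) lowers d(·, c_i) by exactly that amount and
  -- any other distance by at most that amount, so weak and strict comparisons both persist.
  have hstar : ∀ i, ∀ x ∈ V i, ∀ t ∈ Set.Ioc (0 : ℝ) 1, c i + t • (x - c i) ∈ V i := by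
    intro i x hx t ht
    have h1 : dist (c i + t • (x - c i)) (c i) = t * dist x (c i) := by
      rw [dist_eq_norm, add_sub_cancel_left, norm_smul, Real.norm_of_nonneg ht.1.le, dist_eq_norm]
    have h2 : dist x (c i + t • (x - c i)) = (1 - t) * dist x (c i) := by
      rw [dist_eq_norm, dist_eq_norm, ← Real.norm_of_nonneg (sub_nonneg.2 ht.2), ← norm_smul]
      congr 1
      module
    refine ⟨?_, fun j => ?_⟩
    · rw [h1]
      exact (mul_le_of_le_one_left dist_nonneg ht.2).trans_lt hx.1
    · have h3 := dist_triangle x (c i + t • (x - c i)) (c j)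
      rw [h1]
      rw [h2] at h3
      refine ⟨?_, fun hji => ?_⟩
      · linarith [(hx.2 j).1]
      · linarith [(hx.2 j).2 hji]
  have hcell : ∀ i, ∫⁻ x in V i, ‖u x‖ₑ ^ p ≤
      ENNReal.ofReal (((p - 1) / (p - N)) ^ (p - 1) / p * R ^ p) *
        ∫⁻ x in V i, ‖gradient u x‖ₑ ^ p := by
    intro i
    have h := lintegral_sub_rpow_le_of_starShaped hN hp hK (hVm i) (hstar i) (R := R)
      fun x hx => by rw [← dist_eq_norm]; exact hx.1.le
    simpa [hu.apply_eq_zero (hcΩ i)] using h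
  calc ∫⁻ x, ‖u x‖ₑ ^ p ≤ ∫⁻ x in ⋃ i, V i, ‖u x‖ₑ ^ p := by
        rw [← lintegral_indicator (MeasurableSet.iUnion hVm)]
        refine lintegral_mono fun x => ?_
        by_cases hx : x ∈ tsupport u
        · rw [Set.indicator_of_mem (hVcover x hx)]
        · simp [image_eq_zero_of_notMem_tsupport hx, hp0]
    _ = ∑ i, ∫⁻ x in V i, ‖u x‖ₑ ^ p := by
        rw [lintegral_iUnion hVm hVdisj, tsum_fintype]
    _ ≤ ∑ i, ENNReal.ofReal (((p - 1) / (p - N)) ^ (p - 1) / p * R ^ p) *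
          ∫⁻ x in V i, ‖gradient u x‖ₑ ^ p := Finset.sum_le_sum fun i _ => hcell i
    _ = ENNReal.ofReal (((p - 1) / (p - N)) ^ (p - 1) / p * R ^ p) *
          ∫⁻ x in ⋃ i, V i, ‖gradient u x‖ₑ ^ p := by
        rw [lintegral_iUnion hVm hVdisj, tsum_fintype, Finset.mul_sum]
    _ ≤ _ := by
        gcongr
        exact (setLIntegral_le_lintegral _ _).trans (hu.lintegral_gradient_le_dirichletEnergy hp0)

end IsTestFunction

theorem eLpNorm_ofReal_rpow {α : Type*} [MeasurableSpace α] {μ : Measure α} {p : ℝ} (hp : 0 < p)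
    (u : α → ℝ) : eLpNorm u (ENNReal.ofReal p) μ ^ p = ∫⁻ x, ‖u x‖ₑ ^ p ∂μ := by
  rw [eLpNorm_eq_lintegral_rpow_enorm_toReal (by simpa using hp) ENNReal.ofReal_ne_top,
    ENNReal.toReal_ofReal hp.le, ← ENNReal.rpow_mul, one_div_mul_cancel hp.ne', ENNReal.rpow_one]

/-- The constant is the reciprocal of the one in the star-shaped Poincaré inequality. It dominates
β_{N,p}, so this estimate contains the required one. -/
theorem le_principalFrequency {N : ℕ} (hN : 1 ≤ N) {p : ℝ} (hp : (N : ℝ) < p)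
    {Ω : Set (EuclideanSpace ℝ (Fin N))} (hΩ : inradius Ω < ⊤) :
    ENNReal.ofReal (p * ((p - N) / (p - 1)) ^ (p - 1)) / inradius Ω ^ p ≤
      principalFrequency p (ENNReal.ofReal p) Ω := by
  have hN' : (1 : ℝ) ≤ N := by exact_mod_cast hN
  have hp0 : 0 < p := by linarith
  refine le_iInf₂ fun u hu => div_rpow_le_of_forall_gt hp0 hΩ fun R hR hRΩ => ?_
  have hmain := hu.1.lintegral_rpow_le hN hp (exists_notMem_dist_lt_of_inradius_lt hR hRΩ)
  have ha : 0 < ((p - 1) / (p - N)) ^ (p - 1) :=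
    Real.rpow_pos_of_pos (div_pos (by linarith) (by linarith)) _
  have hRp := Real.rpow_pos_of_pos hR p
  have hC : 0 < ((p - 1) / (p - N)) ^ (p - 1) / p * R ^ p := by positivity
  have hX : ENNReal.ofReal (p * ((p - N) / (p - 1)) ^ (p - 1)) / ENNReal.ofReal R ^ p =
      (ENNReal.ofReal (((p - 1) / (p - N)) ^ (p - 1) / p * R ^ p))⁻¹ := by
    rw [ENNReal.ofReal_rpow_of_pos hR, ← ENNReal.ofReal_div_of_pos hRp,
      ← ENNReal.ofReal_inv_of_pos hC]
    congr 1
    rw [← inv_div (p - 1) (p - N), Real.inv_rpow (div_nonneg (by linarith) (by linarith))]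
    field_simp
  have hnorm : eLpNorm u (ENNReal.ofReal p) (volume.restrict Ω) ^ p ≤ ∫⁻ x, ‖u x‖ₑ ^ p := by
    rw [eLpNorm_ofReal_rpow hp0]
    exact setLIntegral_le_lintegral _ _
  rw [hX]
  calc _ ≤ dirichletEnergy p Ω u / ∫⁻ x, ‖u x‖ₑ ^ p := ?_
    _ ≤ _ := by gcongr
  have hc := hu.1.smooth.continuous
  rw [ENNReal.le_div_iff_mul_le, mul_comm, ← div_eq_mul_inv]
  · exact ENNReal.div_le_of_le_mul' hmain
  · left
    obtain ⟨x, hx, -⟩ := hu.1.exists_forall_abs_le hu.2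
    intro h0
    rw [lintegral_eq_zero_iff (by fun_prop)] at h0
    have hcont : Continuous fun x => ‖u x‖ₑ ^ p :=
      ENNReal.continuous_rpow_const.comp hc.enorm
    have := congrFun ((hcont.ae_eq_iff_eq volume continuous_zero).1 h0) x
    simp [hp0, hp0.not_gt, hx] at this
  · left
    have hmem := hc.memLp_of_hasCompactSupport (p := ENNReal.ofReal p) (μ := volume)
      hu.1.hasCompactSupport
    have := lintegral_rpow_enorm_lt_top_of_eLpNorm_lt_top (by simpa using hp0)
      ENNReal.ofReal_ne_top hmem.eLpNorm_lt_top
    rw [ENNReal.toReal_ofReal hp0.le] at this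
    exact this.ne

/-! ### The sup norm and the lower bound for λ_{p,∞} -/

/-- For a continuous function a superlevel set is open, so it cannot be nonempty and null: the
essential supremum bounds every value. -/
theorem enorm_le_eLpNorm_top_restrict {X : Type*} [TopologicalSpace X] [MeasurableSpace X]
    [BorelSpace X] {μ : Measure X} [μ.IsOpenPosMeasure] {v : X → ℝ} (hv : Continuous v) {K : Set X}
    (hK : IsOpen K) {z : X} (hz : z ∈ K) : ‖v z‖ₑ ≤ eLpNorm v ⊤ (μ.restrict K) := by
  by_contra! h
  rw [eLpNorm_exponent_top] at h
  have hae := ae_le_eLpNormEssSup (f := v) (μ := μ.restrict K)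
  rw [ae_restrict_iff' hK.measurableSet] at hae
  have hopen : IsOpen (K ∩ {x | eLpNormEssSup v (μ.restrict K) < ‖v x‖ₑ}) :=
    hK.inter (isOpen_lt continuous_const hv.enorm)
  refine (hopen.measure_pos μ ⟨z, hz, h⟩).ne' (measure_mono_null ?_ hae)
  rintro x ⟨hxK, hx⟩ hle
  exact (hle hxK).not_gt hx

theorem eLpNorm_top_le_of_forall {α : Type*} [MeasurableSpace α] {μ : Measure α} {u : α → ℝ}
    {C : ℝ≥0∞} (h : ∀ᵐ x ∂μ, ‖u x‖ₑ ≤ C) : eLpNorm u ⊤ μ ≤ C := by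
  rw [eLpNorm_exponent_top]
  exact essSup_le_of_ae_le C h

/-- Homogeneity removes the normalisation of the norm: divide u by its norm. When the norm is 0 the
left side is 0, as p > 0. -/
theorem puncturedPoincare_mul_le {N : ℕ} {p : ℝ} (hp : 0 < p) {q : ℝ≥0∞}
    {K : Set (EuclideanSpace ℝ (Fin N))} {x₀ : EuclideanSpace ℝ (Fin N)} {C : ℝ≥0}
    {u : EuclideanSpace ℝ (Fin N) → ℝ} (hu : LipschitzWith C u) (h0 : u x₀ = 0)
    (hfin : eLpNorm u q (volume.restrict K) ≠ ⊤) :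
    puncturedPoincare p q K x₀ * eLpNorm u q (volume.restrict K) ^ p ≤ dirichletEnergy p K u := by
  set M := eLpNorm u q (volume.restrict K) with hM
  rcases eq_or_ne M 0 with hM0 | hM0
  · simp [hM0, hp]
  have hMr : 0 < M.toReal := ENNReal.toReal_pos hM0 hfin
  have hMe : ‖M.toReal⁻¹‖ₑ = M⁻¹ := by
    rw [← ofReal_norm, Real.norm_of_nonneg (by positivity), ENNReal.ofReal_inv_of_pos hMr,
      ENNReal.ofReal_toReal hfin]
  have hle : puncturedPoincare p q K x₀ ≤ dirichletEnergy p K (M.toReal⁻¹ • u) := by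
    refine iInf₂_le _ ⟨⟨_, ((lipschitzWith_smul M.toReal⁻¹).comp hu).lipschitzOnWith⟩, ?_, ?_⟩
    · rw [eLpNorm_const_smul, hMe, ← hM, ENNReal.inv_mul_cancel hM0 hfin]
    · simp [h0]
  have hE : dirichletEnergy p K (M.toReal⁻¹ • u) = (M ^ p)⁻¹ * dirichletEnergy p K u := by
    have hg : ∀ x, ‖gradient (M.toReal⁻¹ • u) x‖ₑ ^ p = (M ^ p)⁻¹ * ‖gradient u x‖ₑ ^ p := by
      intro x
      rw [enorm_gradient, enorm_gradient, fderiv_const_smul_field, Pi.smul_apply, enorm_smul, hMe,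
        ENNReal.mul_rpow_of_nonneg _ _ hp.le, ENNReal.inv_rpow]
    simp only [dirichletEnergy, hg]
    exact lintegral_const_mul' _ _ (ENNReal.inv_ne_top.2 (by simp [hM0, hp.not_gt, hp, hfin]))
  have hMp : M ^ p ≠ 0 := by simp [hM0, hp.not_gt, hfin]
  have hMp' : M ^ p ≠ ⊤ := ENNReal.rpow_ne_top_of_nonneg hp.le hfin
  rw [hE, mul_comm, ← div_eq_mul_inv] at hle
  exact (ENNReal.le_div_iff_mul_le (Or.inl hMp) (Or.inl hMp')).1 hle

/-- Take a maximum point x of |u| and c outside Ω with |x - c| < R. Then v(z) = u(c + Rz) vanishes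
at 0 and attains the maximum inside B_1, so it competes for Λ_{p,∞}; scaling the energy gives the
factor R^(p-N). -/
theorem puncturedBallSup_div_le_principalFrequency {N : ℕ} {p : ℝ} (hp : (N : ℝ) < p)
    {Ω : Set (EuclideanSpace ℝ (Fin N))} (hΩ : inradius Ω < ⊤) :
    puncturedBallSup N p / inradius Ω ^ (p - N) ≤ principalFrequency p ⊤ Ω := by
  have hp0 : 0 < p := (Nat.cast_nonneg N).trans_lt hp
  refine le_iInf₂ fun u hu => div_rpow_le_of_forall_gt (sub_pos.2 hp) hΩ fun R hR hRΩ => ?_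
  obtain ⟨x, hx, hmax⟩ := hu.1.exists_forall_abs_le hu.2
  obtain ⟨c, hc, hcx⟩ := exists_notMem_dist_lt_of_inradius_lt hR hRΩ x
  obtain ⟨K, hK⟩ := hu.1.exists_lipschitzWith
  have hmax' : ∀ z, ‖u z‖ₑ ≤ ‖u x‖ₑ := fun z => enorm_le_iff_norm_le.2 (hmax z)
  set v : EuclideanSpace ℝ (Fin N) → ℝ := fun z => u (c + R • z) with hv
  have hvl : LipschitzWith (K * ‖R‖₊) v := by
    refine hK.comp (LipschitzWith.of_dist_le_mul fun z w => ?_)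
    rw [dist_add_left, dist_smul₀, coe_nnnorm]
  have hv0 : v 0 = 0 := by simp [hv, hu.1.apply_eq_zero hc]
  have hz : R⁻¹ • (x - c) ∈ Metric.ball (0 : EuclideanSpace ℝ (Fin N)) 1 := by
    rw [mem_ball_zero_iff, norm_smul, norm_inv, Real.norm_of_nonneg hR.le, ← dist_eq_norm,
      dist_comm, inv_mul_lt_one₀ hR]
    exact hcx
  have hvz : v (R⁻¹ • (x - c)) = u x := by simp [hv, smul_smul, hR.ne']
  have hnorm : eLpNorm v ⊤ (volume.restrict (Metric.ball 0 1)) = ‖u x‖ₑ := by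
    refine le_antisymm (eLpNorm_top_le_of_forall (ae_of_all _ fun z => hmax' _)) ?_
    rw [← hvz]
    exact enorm_le_eLpNorm_top_restrict hvl.continuous Metric.isOpen_ball hz
  have hgrad : ∀ z, ‖gradient v z‖ₑ ^ p = ENNReal.ofReal (R ^ p) * ‖gradient u (c + R • z)‖ₑ ^ p := by
    intro z
    have hd : HasFDerivAt (fun z : EuclideanSpace ℝ (Fin N) => c + R • z)
        (R • ContinuousLinearMap.id ℝ _) z := ((hasFDerivAt_id z).const_smul R).const_add c
    have hu' : HasFDerivAt u (fderiv ℝ u (c + R • z)) (c + R • z) :=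
      (hu.1.smooth.differentiable (by simp) _).hasFDerivAt
    have := (hu'.comp z hd).fderiv
    change fderiv ℝ v z = _ at this
    rw [enorm_gradient, enorm_gradient, this, ContinuousLinearMap.comp_smul,
      ContinuousLinearMap.comp_id, enorm_smul, ENNReal.mul_rpow_of_nonneg _ _ hp0.le,
      ← ofReal_norm, Real.norm_of_nonneg hR.le, ENNReal.ofReal_rpow_of_pos hR]
  have henergy : dirichletEnergy p (Metric.ball 0 1) v ≤
      ENNReal.ofReal R ^ (p - N) * dirichletEnergy p Ω u := by
    calc dirichletEnergy p (Metric.ball 0 1) v ≤ ∫⁻ z, ‖gradient v z‖ₑ ^ p :=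
          setLIntegral_le_lintegral _ _
      _ = ENNReal.ofReal (R ^ p) * ENNReal.ofReal ((R ^ N)⁻¹) * ∫⁻ z, ‖gradient u z‖ₑ ^ p := by
          simp only [hgrad]
          rw [lintegral_const_mul' _ _ ENNReal.ofReal_ne_top,
            lintegral_comp_add_smul c hR fun z => ‖gradient u z‖ₑ ^ p, mul_assoc]
      _ = ENNReal.ofReal R ^ (p - N) * ∫⁻ z, ‖gradient u z‖ₑ ^ p := by
          rw [← ENNReal.ofReal_mul (Real.rpow_nonneg hR.le _), ENNReal.ofReal_rpow_of_pos hR,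
            Real.rpow_sub hR, Real.rpow_natCast, div_eq_mul_inv]
      _ ≤ _ := by
          gcongr
          exact hu.1.lintegral_gradient_le_dirichletEnergy hp0
  have hmul := puncturedPoincare_mul_le (q := ⊤) (K := Metric.ball 0 1) hp0 hvl hv0
    (by rw [hnorm]; exact enorm_ne_top)
  rw [hnorm] at hmul
  have hux : ‖u x‖ₑ ^ p ≠ 0 := by simp [hx, hp0.not_gt]
  have hux' : ‖u x‖ₑ ^ p ≠ ⊤ := ENNReal.rpow_ne_top_of_nonneg hp0.le enorm_ne_top
  calc _ ≤ dirichletEnergy p Ω u / ‖u x‖ₑ ^ p := by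
        rw [ENNReal.le_div_iff_mul_le (Or.inl hux) (Or.inl hux'), ENNReal.div_eq_inv_mul, mul_assoc,
          ← ENNReal.div_eq_inv_mul]
        exact ENNReal.div_le_of_le_mul' (hmul.trans henergy)
    _ ≤ _ := by
        gcongr
        exact eLpNorm_top_le_of_forall (ae_of_all _ hmax')

/-! ### Lower bounds for the punctured ball constants -/

theorem ofReal_mul_lintegral_sub_rpow_le {N : ℕ} (hN : 1 ≤ N) {p : ℝ} (hp : (N : ℝ) < p)
    {K : ℝ≥0} {u : EuclideanSpace ℝ (Fin N) → ℝ} (hu : LipschitzWith K u)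
    {y : EuclideanSpace ℝ (Fin N)} {R : ℝ} {W : Set (EuclideanSpace ℝ (Fin N))}
    (hW : MeasurableSet W)
    (hstar : ∀ x ∈ W, ∀ t ∈ Set.Ioc (0 : ℝ) 1, y + t • (x - y) ∈ W)
    (hWR : ∀ x ∈ W, ‖x - y‖ ≤ R) :
    ENNReal.ofReal (p * ((p - N) / (p - 1)) ^ (p - 1)) * ∫⁻ x in W, ‖u x - u y‖ₑ ^ p ≤
      ENNReal.ofReal (R ^ p) * ∫⁻ x in W, ‖gradient u x‖ₑ ^ p := by
  have hN' : (1 : ℝ) ≤ N := by exact_mod_cast hN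
  have hp0 : 0 < p := by linarith
  have ha : 0 < ((p - N) / (p - 1)) ^ (p - 1) :=
    Real.rpow_pos_of_pos (div_pos (by linarith) (by linarith)) _
  calc _ ≤ _ := mul_le_mul' le_rfl
        (lintegral_sub_rpow_le_of_starShaped hN hp hu hW hstar hWR)
    _ = _ := by
        rw [← mul_assoc, ← ENNReal.ofReal_mul (by positivity),
          ← inv_div (p - N) (p - 1), Real.inv_rpow (div_nonneg (by linarith) (by linarith))]
        congr 2
        field_simp

theorem add_smul_sub_mem_ball {F : Type*} [NormedAddCommGroup F] [NormedSpace ℝ F] {c y x : F}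
    {r : ℝ} (hy : y ∈ Metric.closedBall c r) (hx : x ∈ Metric.ball c r) {t : ℝ}
    (ht : t ∈ Set.Ioc (0 : ℝ) 1) : y + t • (x - y) ∈ Metric.ball c r := by
  rw [mem_closedBall_iff_norm] at hy
  rw [mem_ball_iff_norm] at hx ⊢
  calc ‖y + t • (x - y) - c‖ = ‖(1 - t) • (y - c) + t • (x - c)‖ := by congr 1; module
    _ ≤ (1 - t) * ‖y - c‖ + t * ‖x - c‖ := by
        refine (norm_add_le _ _).trans_eq ?_
        rw [norm_smul, norm_smul, Real.norm_of_nonneg (sub_nonneg.2 ht.2),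
          Real.norm_of_nonneg ht.1.le]
    _ < (1 - t) * r + t * r :=
        add_lt_add_of_le_of_lt (mul_le_mul_of_nonneg_left hy (sub_nonneg.2 ht.2))
          (mul_lt_mul_of_pos_left hx ht.1)
    _ = r := by ring

/-- Competitors are Lipschitz only on the closure of K, while the ray estimates need a globally
Lipschitz function. A Lipschitz extension has the same gradient on the open set K. -/
theorem exists_lipschitzWith_dirichletEnergy_eq {N : ℕ} {p : ℝ}
    {K : Set (EuclideanSpace ℝ (Fin N))} (hK : IsOpen K) {C : ℝ≥0}
    {u : EuclideanSpace ℝ (Fin N) → ℝ} (hu : LipschitzOnWith C u (closure K)) :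
    ∃ g, LipschitzWith C g ∧ Set.EqOn u g (closure K) ∧
      dirichletEnergy p K u = dirichletEnergy p K g := by
  obtain ⟨g, hg, hug⟩ := hu.extend_real
  refine ⟨g, hg, hug, setLIntegral_congr_fun hK.measurableSet fun x hx => ?_⟩
  have : u =ᶠ[𝓝 x] g :=
    eventually_of_mem (hK.mem_nhds hx) fun z hz => hug (subset_closure hz)
  simp only [gradient, this.fderiv_eq]

theorem le_puncturedBall {N : ℕ} (hN : 1 ≤ N) {p : ℝ} (hp : (N : ℝ) < p) :
    ENNReal.ofReal (p * ((p - N) / (p - 1)) ^ (p - 1)) ≤ puncturedBall N p := by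
  have hp0 : 0 < p := (Nat.cast_nonneg N).trans_lt hp
  refine le_iInf₂ fun u ⟨⟨C, hC⟩, hnorm, h0⟩ => ?_
  obtain ⟨g, hg, hug, hE⟩ := exists_lipschitzWith_dirichletEnergy_eq (p := p) Metric.isOpen_ball hC
  have hg0 : g 0 = 0 := by
    rw [← hug (subset_closure (Metric.mem_ball_self one_pos)), h0]
  have h := ofReal_mul_lintegral_sub_rpow_le hN hp hg (y := 0) (R := 1)
    (W := Metric.ball 0 1) measurableSet_ball
    (fun x hx t ht => add_smul_sub_mem_ball (by simp) hx ht)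
    (fun x hx => by simpa using (mem_ball_zero_iff.1 hx).le)
  have hint : ∫⁻ x in Metric.ball (0 : EuclideanSpace ℝ (Fin N)) 1, ‖g x - g 0‖ₑ ^ p = 1 := by
    rw [← ENNReal.one_rpow p, ← hnorm, eLpNorm_ofReal_rpow hp0]
    refine setLIntegral_congr_fun measurableSet_ball fun x hx => ?_
    simp only [hg0, sub_zero, hug (subset_closure hx)]
  rw [hint, mul_one, Real.one_rpow, ENNReal.ofReal_one, one_mul] at h
  rw [hE]
  exact h

/-- At a maximum point z write the constant g(z) as g - (g - g(z)) on a ball W of radius δ whose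
closure contains z. With E the energy, the Poincaré inequality about 0 bounds the L^p norm of g by
(E/k)^(1/p), and the one about z bounds that of g - g(z) by 2δ (E/k)^(1/p). The free δ matters for
the limit p → ∞. -/
theorem le_puncturedBallSup {N : ℕ} (hN : 1 ≤ N) {p : ℝ} (hp : (N : ℝ) < p) {δ : ℝ}
    (hδ : δ ∈ Set.Ioc (0 : ℝ) 1) :
    ENNReal.ofReal (p * ((p - N) / (p - 1)) ^ (p - 1)) *
        volume (Metric.ball (0 : EuclideanSpace ℝ (Fin N)) δ) ≤
      ENNReal.ofReal ((1 + 2 * δ) ^ p) * puncturedBallSup N p := by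
  have hN' : (1 : ℝ) ≤ N := by exact_mod_cast hN
  have hp0 : 0 < p := by linarith
  have hδ0 := hδ.1
  have hδ' : 0 < (1 + 2 * δ) ^ p := by positivity
  rw [mul_comm (ENNReal.ofReal ((1 + 2 * δ) ^ p)), ← ENNReal.div_le_iff
    (by simpa using hδ') ENNReal.ofReal_ne_top]
  refine le_iInf₂ fun u ⟨⟨C, hC⟩, hnorm, h0⟩ => ?_
  rw [ENNReal.div_le_iff (by simpa using hδ') ENNReal.ofReal_ne_top]
  obtain ⟨g, hg, hug, hE⟩ := exists_lipschitzWith_dirichletEnergy_eq (p := p) Metric.isOpen_ball hC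
  rw [hE]
  have hg0 : g 0 = 0 := by
    rw [← hug (subset_closure (Metric.mem_ball_self one_pos)), h0]
  -- The maximum may sit on the unit sphere, so z is taken in the closed ball.
  obtain ⟨z, hz, hzmax⟩ := (isCompact_closedBall (0 : EuclideanSpace ℝ (Fin N)) 1).exists_isMaxOn
    ⟨0, by simp⟩ hg.continuous.enorm.continuousOn
  have hz1 : 1 ≤ ‖g z‖ₑ := by
    rw [← hnorm]
    refine eLpNorm_top_le_of_forall ?_
    filter_upwards [ae_restrict_mem measurableSet_ball] with x hx
    rw [hug (subset_closure hx)]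
    exact hzmax (Metric.ball_subset_closedBall hx)
  rw [mem_closedBall_zero_iff] at hz
  -- Shrinking z towards 0 by the factor 1 - δ keeps W inside B_1 and z in its closed ball. Each
  -- point of W is thus within 2δ of z, and W is star-shaped about z even when z lies on its
  -- boundary.
  set W := Metric.ball ((1 - δ) • z) δ with hW
  have hzW : z ∈ Metric.closedBall ((1 - δ) • z) δ := by
    rw [mem_closedBall_iff_norm, show z - (1 - δ) • z = δ • z by module, norm_smul,
      Real.norm_of_nonneg hδ0.le]
    exact mul_le_of_le_one_right hδ0.le hz
  have hWB : W ⊆ Metric.ball 0 1 := by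
    refine Metric.ball_subset_ball' ?_
    rw [dist_zero_right, norm_smul, Real.norm_of_nonneg (sub_nonneg.2 hδ.2)]
    nlinarith [hδ.2]
  have h1 := ofReal_mul_lintegral_sub_rpow_le hN hp hg (y := z) (R := 2 * δ)
    (W := W) measurableSet_ball
    (fun x hx t ht => add_smul_sub_mem_ball hzW hx ht)
    (fun x hx => by
      rw [mem_closedBall_iff_norm] at hzW
      rw [hW, mem_ball_iff_norm] at hx
      calc ‖x - z‖ = ‖(x - (1 - δ) • z) - (z - (1 - δ) • z)‖ := by congr 1; module
        _ ≤ _ := norm_sub_le _ _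
        _ ≤ _ := by linarith)
  have h2 := ofReal_mul_lintegral_sub_rpow_le hN hp hg (y := 0) (R := 1)
    (W := Metric.ball 0 1) measurableSet_ball
    (fun x hx t ht => add_smul_sub_mem_ball (by simp) hx ht)
    (fun x hx => by simpa using (mem_ball_zero_iff.1 hx).le)
  set k := ENNReal.ofReal (p * ((p - N) / (p - 1)) ^ (p - 1)) with hk
  set E := dirichletEnergy p (Metric.ball 0 1) g with hEdef
  have hEW : ∫⁻ x in W, ‖gradient g x‖ₑ ^ p ≤ E := lintegral_mono_set hWB
  have h1' : k ^ (1 / p) * eLpNorm (fun x => g x - g z) (ENNReal.ofReal p) (volume.restrict W) ≤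
      ENNReal.ofReal (2 * δ) * E ^ (1 / p) := by
    rw [← ENNReal.rpow_le_rpow_iff hp0, ENNReal.mul_rpow_of_nonneg _ _ hp0.le,
      ENNReal.mul_rpow_of_nonneg _ _ hp0.le, ← ENNReal.rpow_mul, ← ENNReal.rpow_mul,
      one_div_mul_cancel hp0.ne', ENNReal.rpow_one, ENNReal.rpow_one, eLpNorm_ofReal_rpow hp0,
      ENNReal.ofReal_rpow_of_pos (by positivity)]
    exact h1.trans (by gcongr)
  have h2' : k ^ (1 / p) * eLpNorm g (ENNReal.ofReal p) (volume.restrict W) ≤ E ^ (1 / p) := by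
    rw [← ENNReal.rpow_le_rpow_iff hp0, ENNReal.mul_rpow_of_nonneg _ _ hp0.le,
      ← ENNReal.rpow_mul, ← ENNReal.rpow_mul,
      one_div_mul_cancel hp0.ne', ENNReal.rpow_one, ENNReal.rpow_one, eLpNorm_ofReal_rpow hp0]
    rw [Real.one_rpow, ENNReal.ofReal_one, one_mul] at h2
    simp only [hg0, sub_zero] at h2
    refine le_trans ?_ h2
    gcongr
  have hvol : volume W = volume (Metric.ball (0 : EuclideanSpace ℝ (Fin N)) δ) :=
    Measure.addHaar_ball_center _ _ _
  have h3 : volume W ^ (1 / p) ≤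
      eLpNorm g (ENNReal.ofReal p) (volume.restrict W) +
        eLpNorm (fun x => g x - g z) (ENNReal.ofReal p) (volume.restrict W) := by
    have hp1 : 1 ≤ ENNReal.ofReal p := ENNReal.one_le_ofReal.2 (by linarith)
    have hsub := eLpNorm_sub_le (μ := volume.restrict W) (p := ENNReal.ofReal p)
      hg.continuous.aestronglyMeasurable
      ((hg.continuous.sub continuous_const).aestronglyMeasurable (f := fun x => g x - g z)) hp1
    have hc : (g - fun x => g x - g z) = fun _ => g z := by ext x; simp
    rw [hc, eLpNorm_const' _ (by simpa using hp0) ENNReal.ofReal_ne_top,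
      ENNReal.toReal_ofReal hp0.le, Measure.restrict_apply_univ] at hsub
    exact (le_mul_of_one_le_left' hz1).trans hsub
  have h4 : k ^ (1 / p) * volume W ^ (1 / p) ≤ ENNReal.ofReal (1 + 2 * δ) * E ^ (1 / p) :=
    calc _ ≤ _ := mul_le_mul' le_rfl h3
      _ ≤ E ^ (1 / p) + ENNReal.ofReal (2 * δ) * E ^ (1 / p) := by
          rw [mul_add]
          exact add_le_add h2' h1'
      _ = _ := by
          rw [ENNReal.ofReal_add zero_le_one (by positivity), ENNReal.ofReal_one, add_mul, one_mul]
  have h5 := ENNReal.rpow_le_rpow h4 hp0.le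
  rw [ENNReal.mul_rpow_of_nonneg _ _ hp0.le,
      ENNReal.mul_rpow_of_nonneg _ _ hp0.le, ← ENNReal.rpow_mul, ← ENNReal.rpow_mul,
      ← ENNReal.rpow_mul, one_div_mul_cancel hp0.ne', ENNReal.rpow_one, ENNReal.rpow_one,
      ENNReal.rpow_one, ENNReal.ofReal_rpow_of_pos (by positivity), hvol, mul_comm _ E] at h5
  exact h5

/-! ### Upper bounds from the radial test function |x|^a -/

theorem setLIntegral_annulus_norm_rpow {N : ℕ} (hN : 1 ≤ N) {s c : ℝ} (hs : 0 < N + s)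
    (hc0 : 0 ≤ c) (hc1 : c ≤ 1) :
    ∫⁻ x in {x : EuclideanSpace ℝ (Fin N) | c < ‖x‖ ∧ ‖x‖ ≤ 1}, ENNReal.ofReal (‖x‖ ^ s) =
      ENNReal.ofReal (N * volume.real (Metric.ball (0 : EuclideanSpace ℝ (Fin N)) 1) *
        ((1 - c ^ (N + s)) / (N + s))) := by
  have : Nonempty (Fin N) := ⟨⟨0, hN⟩⟩
  have hmem : ∀ x : EuclideanSpace ℝ (Fin N), x ∈ {x | c < ‖x‖ ∧ ‖x‖ ≤ 1} ↔ ‖x‖ ∈ Set.Ioc c 1 :=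
    fun x => Iff.rfl
  have hmeas : MeasurableSet {x : EuclideanSpace ℝ (Fin N) | c < ‖x‖ ∧ ‖x‖ ≤ 1} :=
    measurable_norm measurableSet_Ioc
  set g : ℝ → ℝ := (Set.Ioc c 1).indicator fun y => y ^ s with hg
  have hpow : ∀ y ∈ Set.Ioi (0 : ℝ), y ^ (N - 1) • g y =
      (Set.Ioc c 1).indicator (fun y => y ^ (N + s - 1)) y := by
    intro y hy
    by_cases h : y ∈ Set.Ioc c 1
    · rw [hg, Set.indicator_of_mem h, Set.indicator_of_mem h, smul_eq_mul, ← Real.rpow_natCast,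
        ← Real.rpow_add hy, Nat.cast_sub hN]
      congr 1
      push_cast; ring
    · simp [hg, h]
  have hsub : Set.Ioc c 1 ⊆ Set.Ioi 0 := fun y hy => hc0.trans_lt hy.1
  have hint : IntegrableOn (fun y : ℝ => y ^ (N + s - 1)) (Set.Ioc c 1) :=
    (intervalIntegrable_iff_integrableOn_Ioc_of_le hc1).1
      (intervalIntegral.intervalIntegrable_rpow' (by linarith))
  have hintg : IntegrableOn (fun y => y ^ (N - 1) • g y) (Set.Ioi 0) := by
    refine IntegrableOn.congr_fun ?_ (fun y hy => (hpow y hy).symm) measurableSet_Ioi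
    exact (hint.integrable_indicator measurableSet_Ioc).integrableOn
  have hintE : Integrable (fun x : EuclideanSpace ℝ (Fin N) => g ‖x‖) volume := by
    rw [integrable_fun_norm_addHaar, finrank_euclideanSpace_fin]
    exact hintg
  have hg0 : ∀ y, 0 ≤ g y := fun y =>
    Set.indicator_nonneg (fun y hy => Real.rpow_nonneg (hsub hy).le _) y
  calc _ = ∫⁻ x : EuclideanSpace ℝ (Fin N), ENNReal.ofReal (g ‖x‖) := by
        rw [← lintegral_indicator hmeas]
        refine lintegral_congr fun x => ?_
        by_cases h : ‖x‖ ∈ Set.Ioc c 1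
        · rw [hg, Set.indicator_of_mem ((hmem x).2 h), Set.indicator_of_mem h]
        · rw [hg, Set.indicator_of_notMem (fun h' => h ((hmem x).1 h')),
            Set.indicator_of_notMem h, ENNReal.ofReal_zero]
    _ = _ := by
        rw [← ofReal_integral_eq_lintegral_ofReal hintE (ae_of_all _ fun x => hg0 _),
          integral_fun_norm_addHaar, finrank_euclideanSpace_fin,
          setIntegral_congr_fun measurableSet_Ioi hpow, setIntegral_indicator measurableSet_Ioc,
          Set.inter_eq_self_of_subset_right hsub, ← intervalIntegral.integral_of_le hc1,
          integral_rpow (Or.inl (by linarith)), nsmul_eq_mul, smul_eq_mul, sub_add_cancel,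
          Real.one_rpow, mul_assoc]

/-- The truncation of `r ↦ r ^ a` that is linear on `[0, ε]`. -/
noncomputable def truncPow (a ε r : ℝ) : ℝ := ε ^ (a - 1) * min r ε + max r ε ^ a - ε ^ a

section TruncPow

variable {a ε r : ℝ}

theorem truncPow_of_le (hr : r ≤ ε) : truncPow a ε r = ε ^ (a - 1) * r := by
  rw [truncPow, min_eq_left hr, max_eq_right hr, add_sub_cancel_right]

theorem truncPow_of_ge (hε : 0 < ε) (hr : ε ≤ r) : truncPow a ε r = r ^ a := by
  rw [truncPow, min_eq_right hr, max_eq_left hr, ← Real.rpow_add_one hε.ne', sub_add_cancel,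
    add_sub_cancel_left]

/-- Comparison with r itself bounds the norms of the test functions from below uniformly in ε. -/
theorem le_truncPow (ha : a ≤ 1) (hε : 0 < ε) (hε1 : ε ≤ 1) (hr0 : 0 ≤ r) (hr1 : r ≤ 1) :
    r ≤ truncPow a ε r := by
  rcases le_total r ε with h | h
  · rw [truncPow_of_le h]
    exact le_mul_of_one_le_left hr0
      (Real.one_le_rpow_of_pos_of_le_one_of_nonpos hε hε1 (by linarith))
  · rw [truncPow_of_ge hε h]
    exact Real.self_le_rpow_of_le_one hr0 hr1 ha

theorem truncPow_le_one (ha0 : 0 ≤ a) (hε : 0 < ε) (hε1 : ε ≤ 1) (hr1 : r ≤ 1) :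
    truncPow a ε r ≤ 1 := by
  rcases le_total r ε with h | h
  · rw [truncPow_of_le h]
    calc ε ^ (a - 1) * r ≤ ε ^ (a - 1) * ε := by gcongr
      _ = ε ^ a := by rw [← Real.rpow_add_one hε.ne', sub_add_cancel]
      _ ≤ 1 := Real.rpow_le_one hε.le hε1 ha0
  · rw [truncPow_of_ge hε h]
    exact Real.rpow_le_one (hε.le.trans h) hr1 ha0

/-- The `min` term and the `max` term each contribute a slope of at most ε^(a-1). The wasteful
factor 2 is harmless: its share of the energy vanishes as ε → 0. -/
theorem lipschitzWith_truncPow (ha0 : 0 ≤ a) (ha : a ≤ 1) (hε : 0 < ε) :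
    LipschitzWith (Real.toNNReal (2 * ε ^ (a - 1))) (truncPow a ε) := by
  have hε' := Real.rpow_pos_of_pos hε (a - 1)
  have hpow : LipschitzOnWith (Real.toNNReal (ε ^ (a - 1))) (fun r : ℝ => r ^ a) (Set.Ici ε) := by
    refine (convex_Ici ε).lipschitzOnWith_of_nnnorm_hasDerivWithin_le
      (f' := fun r => a * r ^ (a - 1)) (fun r hr => ?_) (fun r hr => ?_)
    · exact (Real.hasDerivAt_rpow_const (Or.inl (hε.trans_le hr).ne')).hasDerivWithinAt
    · have hr0 : 0 < r := hε.trans_le hr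
      have hr' := Real.rpow_pos_of_pos hr0 (a - 1)
      rw [← NNReal.coe_le_coe, coe_nnnorm, Real.coe_toNNReal _ hε'.le,
        Real.norm_of_nonneg (by positivity)]
      calc a * r ^ (a - 1) ≤ 1 * r ^ (a - 1) := by gcongr
        _ ≤ ε ^ (a - 1) := by
          rw [one_mul]
          exact Real.rpow_le_rpow_of_nonpos hε hr (by linarith)
  refine LipschitzWith.of_dist_le_mul fun r s => ?_
  have h1 : |min r ε - min s ε| ≤ |r - s| := by
    simpa using abs_inf_sub_inf_le_abs r s ε
  have h2 : |max r ε - max s ε| ≤ |r - s| := by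
    simpa using abs_sup_sub_sup_le_abs r s ε
  have h3 := hpow.dist_le_mul (max r ε) (Set.mem_Ici.2 (le_max_right _ _)) (max s ε)
    (Set.mem_Ici.2 (le_max_right _ _))
  rw [Real.coe_toNNReal _ hε'.le, Real.dist_eq, Real.dist_eq] at h3
  rw [Real.coe_toNNReal _ (by positivity), Real.dist_eq, Real.dist_eq]
  calc |truncPow a ε r - truncPow a ε s|
      = |ε ^ (a - 1) * (min r ε - min s ε) + (max r ε ^ a - max s ε ^ a)| := by
        congr 1; simp only [truncPow]; ring
    _ ≤ ε ^ (a - 1) * |min r ε - min s ε| + |max r ε ^ a - max s ε ^ a| := by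
        refine (abs_add_le _ _).trans_eq ?_
        rw [abs_mul, abs_of_pos hε']
    _ ≤ ε ^ (a - 1) * |r - s| + ε ^ (a - 1) * |r - s| := by
        gcongr
        exact h3.trans (by gcongr)
    _ = _ := by ring

end TruncPow

theorem lipschitzWith_truncPow_norm {N : ℕ} {a ε : ℝ} (ha0 : 0 ≤ a) (ha : a ≤ 1) (hε : 0 < ε) :
    LipschitzWith (Real.toNNReal (2 * ε ^ (a - 1)))
      fun x : EuclideanSpace ℝ (Fin N) => truncPow a ε ‖x‖ := by
  have h := (lipschitzWith_truncPow ha0 ha hε).comp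
    (lipschitzWith_one_norm (E := EuclideanSpace ℝ (Fin N)))
  rwa [mul_one] at h

theorem enorm_gradient_truncPow_norm_le {N : ℕ} {a ε : ℝ} (ha0 : 0 ≤ a) (hε : 0 < ε)
    {x : EuclideanSpace ℝ (Fin N)} (hx : ε < ‖x‖) :
    ‖gradient (fun x : EuclideanSpace ℝ (Fin N) => truncPow a ε ‖x‖) x‖ₑ ≤
      ENNReal.ofReal (a * ‖x‖ ^ (a - 1)) := by
  have hx0 : 0 < ‖x‖ := hε.trans hx
  have hev : (fun x : EuclideanSpace ℝ (Fin N) => truncPow a ε ‖x‖) =ᶠ[𝓝 x] fun x => ‖x‖ ^ a := by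
    filter_upwards [(isOpen_lt continuous_const continuous_norm).mem_nhds hx] with z hz
    exact truncPow_of_ge hε (le_of_lt hz)
  have hd : DifferentiableAt ℝ (fun x : EuclideanSpace ℝ (Fin N) => ‖x‖) x :=
    (contDiffAt_norm ℝ (norm_pos_iff.1 hx0)).differentiableAt one_ne_zero
  have h := ((Real.hasDerivAt_rpow_const (p := a) (Or.inl hx0.ne')).comp_hasFDerivAt x
    hd.hasFDerivAt).fderiv
  simp only [Function.comp_def] at h
  rw [enorm_gradient, hev.fderiv_eq, h, ← ofReal_norm, norm_smul,
    Real.norm_of_nonneg (by positivity)]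
  refine ENNReal.ofReal_le_ofReal (mul_le_of_le_one_right (by positivity) ?_)
  simpa using norm_fderiv_le_of_lipschitz ℝ (x₀ := x)
    (lipschitzWith_one_norm (E := EuclideanSpace ℝ (Fin N)))

/-- The core |x| ≤ ε is controlled by the Lipschitz constant and the shell ε < |x| ≤ 1 by |∇|x|^a| =
a |x|^(a-1) in polar coordinates. -/
theorem dirichletEnergy_truncPow_norm_le {N : ℕ} (hN : 1 ≤ N) {p : ℝ} (hp : (N : ℝ) < p) {ε : ℝ}
    (hε : 0 < ε) (hε1 : ε ≤ 1) :
    dirichletEnergy p (Metric.ball (0 : EuclideanSpace ℝ (Fin N)) 1)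
        (fun x => truncPow ((p - N) / (p - 1)) ε ‖x‖) ≤
      ENNReal.ofReal (volume.real (Metric.ball (0 : EuclideanSpace ℝ (Fin N)) 1) *
        (2 ^ p * ε ^ ((p - N) / (p - 1)) + N * ((p - N) / (p - 1)) ^ (p - 1))) := by
  have hN' : (1 : ℝ) ≤ N := by exact_mod_cast hN
  have hp0 : 0 < p := by linarith
  set a := (p - N) / (p - 1) with ha_def
  have ha0 : 0 < a := div_pos (by linarith) (by linarith)
  have ha1 : a ≤ 1 := by rw [ha_def, div_le_one] <;> linarith
  -- This identity is special to a = (p - N)/(p - 1). It makes the core of order ε^a and the radial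
  -- integral on the shell equal to (1 - ε^a)/a.
  have hexp : (N : ℝ) + (a - 1) * p = a := by
    have : p - 1 ≠ 0 := by linarith
    rw [ha_def]; field_simp; ring
  set V := volume.real (Metric.ball (0 : EuclideanSpace ℝ (Fin N)) 1) with hV
  have hV0 : 0 ≤ V := measureReal_nonneg
  have hε' := Real.rpow_pos_of_pos hε (a - 1)
  set u : EuclideanSpace ℝ (Fin N) → ℝ := fun x => truncPow a ε ‖x‖ with hu
  have h1 : ∫⁻ x in Metric.closedBall 0 ε, ‖gradient u x‖ₑ ^ p ≤
      ENNReal.ofReal (V * (2 ^ p * ε ^ a)) := by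
    have hbound : ∀ x, ‖gradient u x‖ₑ ^ p ≤ ENNReal.ofReal ((2 * ε ^ (a - 1)) ^ p) := fun x => by
      rw [← ENNReal.ofReal_rpow_of_pos (by positivity), enorm_gradient, ← ofReal_norm]
      gcongr
      refine (norm_fderiv_le_of_lipschitz ℝ
        (lipschitzWith_truncPow_norm (N := N) ha0.le ha1 hε)).trans_eq ?_
      rw [Real.coe_toNNReal _ (by positivity)]
    calc _ ≤ ∫⁻ x in Metric.closedBall (0 : EuclideanSpace ℝ (Fin N)) ε,
          ENNReal.ofReal ((2 * ε ^ (a - 1)) ^ p) := lintegral_mono fun x => hbound x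
      _ = ENNReal.ofReal ((2 * ε ^ (a - 1)) ^ p) * ENNReal.ofReal (ε ^ N * V) := by
          rw [setLIntegral_const, Measure.addHaar_closedBall _ _ hε.le, finrank_euclideanSpace_fin,
            ENNReal.ofReal_mul (by positivity), hV, measureReal_def, ENNReal.ofReal_toReal
            measure_ball_lt_top.ne]
      _ = _ := by
          rw [← ENNReal.ofReal_mul (by positivity), Real.mul_rpow (by norm_num) hε'.le,
            ← Real.rpow_mul hε.le]
          congr 1
          have : ε ^ ((a - 1) * p) * ε ^ N = ε ^ a := by
            rw [← Real.rpow_natCast, ← Real.rpow_add hε, add_comm, hexp]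
          rw [← this]; ring
  have h2 : ∫⁻ x in {x : EuclideanSpace ℝ (Fin N) | ε < ‖x‖ ∧ ‖x‖ ≤ 1}, ‖gradient u x‖ₑ ^ p ≤
      ENNReal.ofReal (V * (N * a ^ (p - 1))) := by
    have hmeas : MeasurableSet {x : EuclideanSpace ℝ (Fin N) | ε < ‖x‖ ∧ ‖x‖ ≤ 1} :=
      measurable_norm measurableSet_Ioc
    calc _ ≤ ∫⁻ x in {x : EuclideanSpace ℝ (Fin N) | ε < ‖x‖ ∧ ‖x‖ ≤ 1},
            ENNReal.ofReal (a ^ p) * ENNReal.ofReal (‖x‖ ^ ((a - 1) * p)) := by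
          refine setLIntegral_mono' hmeas fun x hx => ?_
          have hx0 : 0 < ‖x‖ := hε.trans hx.1
          have hx' := Real.rpow_pos_of_pos hx0 (a - 1)
          rw [← ENNReal.ofReal_mul (by positivity), Real.rpow_mul hx0.le,
            ← Real.mul_rpow ha0.le hx'.le, ← ENNReal.ofReal_rpow_of_pos (by positivity)]
          exact ENNReal.rpow_le_rpow (enorm_gradient_truncPow_norm_le ha0.le hε hx.1) hp0.le
      _ = ENNReal.ofReal (a ^ p) * ENNReal.ofReal (N * V * ((1 - ε ^ a) / a)) := by
          rw [lintegral_const_mul' _ _ ENNReal.ofReal_ne_top,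
            setLIntegral_annulus_norm_rpow hN (by rw [hexp]; exact ha0) hε.le hε1, hexp]
      _ ≤ _ := by
          rw [← ENNReal.ofReal_mul (by positivity)]
          refine ENNReal.ofReal_le_ofReal ?_
          have hap : a ^ p = a ^ (p - 1) * a := by rw [← Real.rpow_add_one ha0.ne', sub_add_cancel]
          have : a ^ p * (N * V * ((1 - ε ^ a) / a)) = V * (N * a ^ (p - 1)) * (1 - ε ^ a) := by
            rw [hap]; field_simp
          rw [this]
          exact mul_le_of_le_one_right (by positivity)
            (by linarith [Real.rpow_nonneg hε.le a])
  calc dirichletEnergy p (Metric.ball 0 1) u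
      ≤ ∫⁻ x in Metric.closedBall 0 ε ∪ {x : EuclideanSpace ℝ (Fin N) | ε < ‖x‖ ∧ ‖x‖ ≤ 1},
          ‖gradient u x‖ₑ ^ p := by
        refine lintegral_mono_set fun x hx => ?_
        rw [mem_ball_zero_iff] at hx
        rcases le_or_gt ‖x‖ ε with h | h
        · exact Or.inl (mem_closedBall_zero_iff.2 h)
        · exact Or.inr ⟨h, hx.le⟩
    _ ≤ _ := lintegral_union_le _ _ _
    _ ≤ _ := add_le_add h1 h2
    _ = _ := by
        rw [← ENNReal.ofReal_add (by positivity) (by positivity), mul_add]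

/-- |x|^a need not be Lipschitz at 0, so its truncations are tested and ε is sent to 0. This
requires a lower bound m for the norms that does not depend on ε. -/
theorem puncturedPoincare_mul_le_of_truncPow {N : ℕ} (hN : 1 ≤ N) {p : ℝ} (hp : (N : ℝ) < p)
    {q : ℝ≥0∞} {m : ℝ≥0∞}
    (hm : ∀ ε : ℝ, 0 < ε → ε ≤ 1 → m ≤ eLpNorm (fun x => truncPow ((p - N) / (p - 1)) ε ‖x‖) q
      (volume.restrict (Metric.ball (0 : EuclideanSpace ℝ (Fin N)) 1)) ^ p) :
    puncturedPoincare p q (Metric.ball (0 : EuclideanSpace ℝ (Fin N)) 1) 0 * m ≤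
      ENNReal.ofReal (volume.real (Metric.ball (0 : EuclideanSpace ℝ (Fin N)) 1) *
        (N * ((p - N) / (p - 1)) ^ (p - 1))) := by
  have hN' : (1 : ℝ) ≤ N := by exact_mod_cast hN
  have hp0 : 0 < p := by linarith
  set a := (p - N) / (p - 1) with ha_def
  have ha0 : 0 < a := div_pos (by linarith) (by linarith)
  have ha1 : a ≤ 1 := by rw [ha_def, div_le_one] <;> linarith
  set V := volume.real (Metric.ball (0 : EuclideanSpace ℝ (Fin N)) 1) with hV
  have ht : Tendsto (fun ε : ℝ => ENNReal.ofReal (V * (2 ^ p * ε ^ a + N * a ^ (p - 1)))) (𝓝[>] 0)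
      (𝓝 (ENNReal.ofReal (V * (N * a ^ (p - 1))))) := by
    have hc : ContinuousAt (fun ε : ℝ => ENNReal.ofReal (V * (2 ^ p * ε ^ a + N * a ^ (p - 1)))) 0 :=
      ENNReal.continuous_ofReal.continuousAt.comp (continuousAt_const.mul
        ((continuousAt_const.mul (Real.continuousAt_rpow_const _ _ (Or.inr ha0.le))).add
          continuousAt_const))
    have := hc.tendsto.mono_left (nhdsWithin_le_nhds (s := Set.Ioi 0))
    simpa [Real.zero_rpow ha0.ne'] using this
  refine ge_of_tendsto ht ?_
  filter_upwards [Ioc_mem_nhdsGT one_pos] with ε hε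
  have hl := lipschitzWith_truncPow_norm (N := N) ha0.le ha1 hε.1
  refine le_trans ?_ (dirichletEnergy_truncPow_norm_le hN hp hε.1 hε.2)
  refine le_trans (mul_le_mul' le_rfl (hm ε hε.1 hε.2)) ?_
  refine puncturedPoincare_mul_le hp0 hl (by simp [truncPow_of_le hε.1.le]) ?_
  have : IsFiniteMeasure
      (volume.restrict (Metric.ball (0 : EuclideanSpace ℝ (Fin N)) 1)) :=
    ⟨by simpa using measure_ball_lt_top⟩
  have hb : MemLp (fun x : EuclideanSpace ℝ (Fin N) => truncPow a ε ‖x‖) q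
      (volume.restrict (Metric.ball (0 : EuclideanSpace ℝ (Fin N)) 1)) := by
    refine MemLp.of_bound hl.continuous.aestronglyMeasurable 1 ?_
    filter_upwards [ae_restrict_mem measurableSet_ball] with x hx
    rw [mem_ball_zero_iff] at hx
    rw [Real.norm_of_nonneg ((norm_nonneg x).trans
      (le_truncPow ha1 hε.1 hε.2 (norm_nonneg x) hx.le))]
    exact truncPow_le_one ha0.le hε.1 hε.2 hx.le
  exact hb.eLpNorm_ne_top

theorem puncturedBallSup_le {N : ℕ} (hN : 1 ≤ N) {p : ℝ} (hp : (N : ℝ) < p) :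
    puncturedBallSup N p ≤
      ENNReal.ofReal (volume.real (Metric.ball (0 : EuclideanSpace ℝ (Fin N)) 1) *
        (N * ((p - N) / (p - 1)) ^ (p - 1))) := by
  have hN' : (1 : ℝ) ≤ N := by exact_mod_cast hN
  have : Nonempty (Fin N) := ⟨⟨0, hN⟩⟩
  have hp0 : 0 < p := by linarith
  have ha0 : 0 < (p - N) / (p - 1) := div_pos (by linarith) (by linarith)
  have ha1 : (p - N) / (p - 1) ≤ 1 := by rw [div_le_one] <;> linarith
  refine le_trans (mul_one _).ge
    (puncturedPoincare_mul_le_of_truncPow hN hp fun ε hε hε1 => ?_)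
  rw [← ENNReal.one_rpow p]
  gcongr
  -- The value 1 is reached only on the sphere; points of norm c < 1 in the open ball approximate
  -- it.
  refine le_of_forall_lt_imp_le_of_dense fun c hc => ?_
  have hctop : c ≠ ⊤ := (hc.trans ENNReal.one_lt_top).ne
  obtain ⟨x, hx⟩ := exists_norm_eq (EuclideanSpace ℝ (Fin N))
    (ENNReal.toReal_nonneg (a := c))
  have hx1 : ‖x‖ < 1 := by
    rw [hx, ← ENNReal.toReal_one]
    exact (ENNReal.toReal_lt_toReal hctop ENNReal.one_ne_top).2 hc
  refine le_trans ?_ (enorm_le_eLpNorm_top_restrict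
    (lipschitzWith_truncPow_norm (N := N) ha0.le ha1 hε).continuous Metric.isOpen_ball
    (mem_ball_zero_iff.2 hx1))
  have hle := le_truncPow ha1 hε hε1 (norm_nonneg x) hx1.le
  rw [← ofReal_norm, Real.norm_of_nonneg ((norm_nonneg x).trans hle)]
  calc c = ENNReal.ofReal ‖x‖ := by rw [hx, ENNReal.ofReal_toReal hctop]
    _ ≤ _ := ENNReal.ofReal_le_ofReal hle

/-- The test functions dominate |x|, and ∫_{B_1} |x|^p = N|B_1|/(N + p). Dividing the energy N|B_1|
a^(p-1) by this cancels the volume. -/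
theorem puncturedBall_le {N : ℕ} (hN : 1 ≤ N) {p : ℝ} (hp : (N : ℝ) < p) :
    puncturedBall N p ≤ ENNReal.ofReal ((N + p) * ((p - N) / (p - 1)) ^ (p - 1)) := by
  have hN' : (1 : ℝ) ≤ N := by exact_mod_cast hN
  have : Nonempty (Fin N) := ⟨⟨0, hN⟩⟩
  have hp0 : 0 < p := by linarith
  have ha0 : 0 < (p - N) / (p - 1) := div_pos (by linarith) (by linarith)
  have ha1 : (p - N) / (p - 1) ≤ 1 := by rw [div_le_one] <;> linarith
  have hap := Real.rpow_pos_of_pos ha0 (p - 1)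
  set V := volume.real (Metric.ball (0 : EuclideanSpace ℝ (Fin N)) 1) with hV
  have hV0 : 0 < V := by
    rw [hV, measureReal_def]
    exact ENNReal.toReal_pos (Metric.measure_ball_pos _ _ one_pos).ne' measure_ball_lt_top.ne
  have h := puncturedPoincare_mul_le_of_truncPow hN hp (q := ENNReal.ofReal p)
    (m := ENNReal.ofReal (N * V / (N + p))) fun ε hε hε1 => by
      rw [eLpNorm_ofReal_rpow hp0]
      calc ENNReal.ofReal (N * V / (N + p))
          = ∫⁻ x in {x : EuclideanSpace ℝ (Fin N) | 0 < ‖x‖ ∧ ‖x‖ ≤ 1},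
              ENNReal.ofReal (‖x‖ ^ p) := by
            rw [setLIntegral_annulus_norm_rpow hN (by positivity) le_rfl zero_le_one,
              Real.zero_rpow (by positivity), sub_zero, mul_one_div]
        _ ≤ ∫⁻ x in Metric.closedBall (0 : EuclideanSpace ℝ (Fin N)) 1,
              ENNReal.ofReal (‖x‖ ^ p) :=
            lintegral_mono_set fun x hx => mem_closedBall_zero_iff.2 hx.2
        _ = ∫⁻ x in Metric.ball (0 : EuclideanSpace ℝ (Fin N)) 1, ENNReal.ofReal (‖x‖ ^ p) :=
            setLIntegral_congr (ae_eq_of_subset_of_measure_ge Metric.ball_subset_closedBall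
              (Measure.addHaar_closedBall_eq_addHaar_ball _ _ _).le
              measurableSet_ball.nullMeasurableSet measure_closedBall_lt_top.ne).symm
        _ ≤ _ := by
            refine setLIntegral_mono' measurableSet_ball fun x hx => ?_
            have hle := le_truncPow ha1 hε hε1 (norm_nonneg x) (mem_ball_zero_iff.1 hx).le
            rw [← ENNReal.ofReal_rpow_of_nonneg (norm_nonneg x) hp0.le, ← ofReal_norm,
              Real.norm_of_nonneg ((norm_nonneg x).trans hle)]
            gcongr
  have hm : 0 < N * V / (N + p) := by positivity
  refine ((ENNReal.le_div_iff_mul_le (Or.inl (by simpa using hm))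
    (Or.inl ENNReal.ofReal_ne_top)).2 h).trans_eq ?_
  rw [← hV, ← ENNReal.ofReal_div_of_pos hm]
  congr 1
  field_simp

/-! ### Comparison of constants and behaviour as p ↘ N -/

theorem div_rpow_le_mul_rpow {N : ℕ} (hN : 1 ≤ N) {p : ℝ} (hp : (N : ℝ) < p) :
    ((p - N) / p) ^ p ≤ p * ((p - N) / (p - 1)) ^ (p - 1) := by
  have hN' : (1 : ℝ) ≤ N := by exact_mod_cast hN
  have hp0 : 0 < p := by linarith
  have h0 : 0 < (p - N) / p := div_pos (by linarith) hp0
  have ha : 0 < (p - N) / (p - 1) := div_pos (by linarith) (by linarith)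
  calc ((p - N) / p) ^ p ≤ ((p - N) / p) ^ (p - 1) :=
        Real.rpow_le_rpow_of_exponent_ge h0 (by rw [div_le_one hp0]; linarith) (by linarith)
    _ ≤ ((p - N) / (p - 1)) ^ (p - 1) := by
        refine Real.rpow_le_rpow h0.le ?_ (by linarith)
        exact div_le_div_of_nonneg_left (by linarith) (by linarith) (by linarith)
    _ ≤ _ := le_mul_of_one_le_left (Real.rpow_nonneg ha.le _) (by linarith)

/-- The link between β_{N,p} and k. For the first term, N + p ≤ 2p and (√N + 1)^p ≥ 2 suffice. -/
theorem betaConst_le {N : ℕ} (hN : 1 ≤ N) {p : ℝ} (hp : (N : ℝ) < p) :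
    betaConst N p ≤ ENNReal.ofReal (p * ((p - N) / (p - 1)) ^ (p - 1)) := by
  have hN' : (1 : ℝ) ≤ N := by exact_mod_cast hN
  have hp0 : 0 < p := by linarith
  refine max_le ?_ (ENNReal.ofReal_le_ofReal (div_rpow_le_mul_rpow hN hp))
  have ha : 0 ≤ ((p - N) / (p - 1)) ^ (p - 1) :=
    Real.rpow_nonneg (div_nonneg (by linarith) (by linarith)) _
  have hs : 1 ≤ √(N : ℝ) := Real.one_le_sqrt.2 hN'
  have h2 : 2 ≤ (√(N : ℝ) + 1) ^ p := by
    calc (2 : ℝ) ≤ √(N : ℝ) + 1 := by linarith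
      _ ≤ _ := Real.self_le_rpow_of_one_le (by linarith) (by linarith)
  refine ENNReal.div_le_of_le_mul ((puncturedBall_le hN hp).trans ?_)
  rw [← ENNReal.ofReal_mul (by positivity)]
  refine ENNReal.ofReal_le_ofReal ?_
  rw [mul_right_comm]
  gcongr
  nlinarith

theorem le_betaConst {N : ℕ} (hN : 1 ≤ N) {p : ℝ} (hp : (N : ℝ) < p) :
    ENNReal.ofReal (p * ((p - N) / (p - 1)) ^ (p - 1) / (√(N : ℝ) + 1) ^ p) ≤ betaConst N p := by
  have hs : 0 < (√(N : ℝ) + 1) ^ p := by positivity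
  rw [ENNReal.ofReal_div_of_pos hs]
  exact (ENNReal.div_le_div_right (le_puncturedBall hN hp) _).trans (le_max_left _ _)

/-- The ratio of ((p-N)/(p-1))^(p-1) to (p-N)^(p-1) is (p-1)^(-(p-1)), which stays between positive
constants for N < p < N + 1. -/
theorem liminf_pos_and_limsup_lt_top_of_bounds {N : ℕ} (hN : 1 ≤ N) {F : ℝ → ℝ≥0∞} {c C : ℝ}
    (hc : 0 < c) (hC : 0 ≤ C)
    (hF : ∀ p : ℝ, (N : ℝ) < p → p < N + 1 →
      ENNReal.ofReal (c * ((p - N) / (p - 1)) ^ (p - 1)) ≤ F p ∧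
        F p ≤ ENNReal.ofReal (C * ((p - N) / (p - 1)) ^ (p - 1))) :
    0 < liminf (fun p : ℝ => F p / ENNReal.ofReal ((p - N) ^ (p - 1))) (𝓝[>] (N : ℝ)) ∧
      limsup (fun p : ℝ => F p / ENNReal.ofReal ((p - N) ^ (p - 1))) (𝓝[>] (N : ℝ)) < ⊤ := by
  have hN' : (1 : ℝ) ≤ N := by exact_mod_cast hN
  have hNN : (0 : ℝ) < (N : ℝ) ^ (N : ℝ) := Real.rpow_pos_of_pos (by linarith) _
  have hev : ∀ᶠ p in 𝓝[>] (N : ℝ), (N : ℝ) < p ∧ p < N + 1 :=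
    Ioo_mem_nhdsGT (by linarith)
  have hdiv : ∀ p : ℝ, (N : ℝ) < p → ∀ b : ℝ,
      ENNReal.ofReal (b * ((p - N) / (p - 1)) ^ (p - 1)) / ENNReal.ofReal ((p - N) ^ (p - 1)) =
        ENNReal.ofReal (b / (p - 1) ^ (p - 1)) := by
    intro p hp b
    have h1 : 0 < (p - N) ^ (p - 1) := Real.rpow_pos_of_pos (by linarith) _
    rw [← ENNReal.ofReal_div_of_pos h1, Real.div_rpow (by linarith) (by linarith)]
    congr 1
    field_simp
  constructor
  · refine lt_of_lt_of_le (b := ENNReal.ofReal (c / (N : ℝ) ^ (N : ℝ)))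
      (ENNReal.ofReal_pos.2 (by positivity)) (le_liminf_of_le (by isBoundedDefault) ?_)
    filter_upwards [hev] with p hp
    refine le_trans ?_ (ENNReal.div_le_div_right (hF p hp.1 hp.2).1 _)
    rw [hdiv p hp.1]
    have h1 : 0 < (p - 1) ^ (p - 1) := Real.rpow_pos_of_pos (by linarith) _
    refine ENNReal.ofReal_le_ofReal (div_le_div_of_nonneg_left hc.le h1 ?_)
    calc (p - 1) ^ (p - 1) ≤ (N : ℝ) ^ (p - 1) :=
          Real.rpow_le_rpow (by linarith) (by linarith) (by linarith)
      _ ≤ (N : ℝ) ^ (N : ℝ) := Real.rpow_le_rpow_of_exponent_le hN' (by linarith)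
  -- With t = p - 1, the inequality t log t ≥ t - 1 ≥ -1 gives t^t ≥ e^(-1). This also covers N = 1,
  -- where t tends to 0.
  · refine lt_of_le_of_lt (b := ENNReal.ofReal (C / Real.exp (-1)))
      (limsup_le_of_le (by isBoundedDefault) ?_) ENNReal.ofReal_lt_top
    filter_upwards [hev] with p hp
    refine (ENNReal.div_le_div_right (hF p hp.1 hp.2).2 _).trans ?_
    rw [hdiv p hp.1]
    have h0 : 0 < p - 1 := by linarith
    refine ENNReal.ofReal_le_ofReal (div_le_div_of_nonneg_left hC (Real.exp_pos _) ?_)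
    rw [Real.rpow_def_of_pos h0]
    refine Real.exp_le_exp.2 ?_
    have h1 := mul_le_mul_of_nonneg_right (Real.one_sub_inv_le_log_of_pos h0) h0.le
    rw [sub_mul, inv_mul_cancel₀ h0.ne'] at h1
    linarith

theorem betaConst_asymptotics {N : ℕ} (hN : 1 ≤ N) :
    0 < liminf (fun p : ℝ => betaConst N p / ENNReal.ofReal ((p - N) ^ (p - 1)))
        (𝓝[>] (N : ℝ)) ∧
      limsup (fun p : ℝ => betaConst N p / ENNReal.ofReal ((p - N) ^ (p - 1)))
        (𝓝[>] (N : ℝ)) < ⊤ := by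
  have hN' : (1 : ℝ) ≤ N := by exact_mod_cast hN
  refine liminf_pos_and_limsup_lt_top_of_bounds hN
    (c := 1 / (√(N : ℝ) + 1) ^ ((N : ℝ) + 1)) (C := N + 1) (by positivity) (by positivity)
    fun p hp hp1 => ⟨le_trans ?_ (le_betaConst hN hp), (betaConst_le hN hp).trans ?_⟩
  all_goals
    have ha : 0 ≤ ((p - N) / (p - 1)) ^ (p - 1) :=
      Real.rpow_nonneg (div_nonneg (by linarith) (by linarith)) _
    refine ENNReal.ofReal_le_ofReal ?_
  · rw [div_mul_eq_mul_div, one_mul]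
    have hs : 1 ≤ √(N : ℝ) + 1 := by linarith [Real.sqrt_nonneg (N : ℝ)]
    have hle := le_mul_of_one_le_left ha (show 1 ≤ p by linarith)
    exact div_le_div₀ (ha.trans hle) hle (by positivity)
      (Real.rpow_le_rpow_of_exponent_le hs hp1.le)
  · gcongr

theorem measureReal_ball_pos {N : ℕ} {r : ℝ} (hr : 0 < r) :
    0 < volume.real (Metric.ball (0 : EuclideanSpace ℝ (Fin N)) r) :=
  ENNReal.toReal_pos (Metric.measure_ball_pos _ _ hr).ne' measure_ball_lt_top.ne

theorem ofReal_le_puncturedBallSup {N : ℕ} (hN : 1 ≤ N) {p : ℝ} (hp : (N : ℝ) < p) {δ : ℝ}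
    (hδ : δ ∈ Set.Ioc (0 : ℝ) 1) :
    ENNReal.ofReal (p * ((p - N) / (p - 1)) ^ (p - 1) *
        volume.real (Metric.ball (0 : EuclideanSpace ℝ (Fin N)) δ) / (1 + 2 * δ) ^ p) ≤
      puncturedBallSup N p := by
  have hN' : (1 : ℝ) ≤ N := by exact_mod_cast hN
  have hδ0 := hδ.1
  have hδ' : 0 < (1 + 2 * δ) ^ p := by positivity
  have ha : 0 ≤ ((p - N) / (p - 1)) ^ (p - 1) :=
    Real.rpow_nonneg (div_nonneg (by linarith) (by linarith)) _
  rw [ENNReal.ofReal_div_of_pos hδ', ENNReal.ofReal_mul (mul_nonneg (by linarith) ha),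
    measureReal_def, ENNReal.ofReal_toReal measure_ball_lt_top.ne]
  exact ENNReal.div_le_of_le_mul' (le_puncturedBallSup hN hp hδ)

theorem puncturedBallSup_asymptotics {N : ℕ} (hN : 1 ≤ N) :
    0 < liminf (fun p : ℝ => puncturedBallSup N p / ENNReal.ofReal ((p - N) ^ (p - 1)))
        (𝓝[>] (N : ℝ)) ∧
      limsup (fun p : ℝ => puncturedBallSup N p / ENNReal.ofReal ((p - N) ^ (p - 1)))
        (𝓝[>] (N : ℝ)) < ⊤ := by
  have hN' : (1 : ℝ) ≤ N := by exact_mod_cast hN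
  have hV := measureReal_ball_pos (N := N) one_pos
  refine liminf_pos_and_limsup_lt_top_of_bounds hN
    (c := volume.real (Metric.ball (0 : EuclideanSpace ℝ (Fin N)) 1) / 3 ^ ((N : ℝ) + 1))
    (C := volume.real (Metric.ball (0 : EuclideanSpace ℝ (Fin N)) 1) * N)
    (by positivity) (by positivity)
    fun p hp hp1 => ⟨le_trans ?_ (ofReal_le_puncturedBallSup hN hp ⟨one_pos, le_rfl⟩),
      (puncturedBallSup_le hN hp).trans_eq (by rw [mul_assoc])⟩
  have ha : 0 ≤ ((p - N) / (p - 1)) ^ (p - 1) :=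
    Real.rpow_nonneg (div_nonneg (by linarith) (by linarith)) _
  refine ENNReal.ofReal_le_ofReal ?_
  rw [div_mul_eq_mul_div, show (1 : ℝ) + 2 * 1 = 3 by norm_num, mul_comm]
  have hle := le_mul_of_one_le_left ha (show 1 ≤ p by linarith)
  exact div_le_div₀ (mul_nonneg (ha.trans hle) hV.le) (mul_le_mul_of_nonneg_right hle hV.le)
    (by positivity) (Real.rpow_le_rpow_of_exponent_le (by norm_num) hp1.le)

/-! ### Limits of p-th roots as p → ∞ -/

theorem tendsto_sub_div_self_atTop (c : ℝ) :
    Tendsto (fun p : ℝ => (p - c) / p) atTop (𝓝 1) := by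
  have h : Tendsto (fun p : ℝ => 1 - c / p) atTop (𝓝 (1 - 0)) :=
    tendsto_const_nhds.sub (tendsto_const_nhds.div_atTop tendsto_id)
  rw [sub_zero] at h
  refine h.congr' ?_
  filter_upwards [eventually_gt_atTop 0] with p hp
  field_simp

theorem tendsto_const_rpow_one_div_atTop {c : ℝ} (hc : 0 < c) :
    Tendsto (fun p : ℝ => c ^ (1 / p)) atTop (𝓝 1) := by
  have h : Tendsto (fun p : ℝ => 1 / p) atTop (𝓝 0) := by
    simpa using tendsto_inv_atTop_zero (𝕜 := ℝ)
  simpa [Function.comp_def] using (Real.continuousAt_const_rpow hc.ne').tendsto.comp h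

/-- Squeeze between (p - N)/p, from the second term of the maximum, and p^(1/p), from β_{N,p} ≤ k ≤
p. -/
theorem tendsto_betaConst_rpow {N : ℕ} (hN : 1 ≤ N) :
    Tendsto (fun p : ℝ => betaConst N p ^ (1 / p)) atTop (𝓝 1) := by
  have hN' : (1 : ℝ) ≤ N := by exact_mod_cast hN
  have h1 := (ENNReal.continuous_ofReal.tendsto 1).comp (tendsto_sub_div_self_atTop N)
  have h2 := (ENNReal.continuous_ofReal.tendsto 1).comp tendsto_rpow_div
  rw [ENNReal.ofReal_one] at h1 h2
  refine tendsto_of_tendsto_of_tendsto_of_le_of_le' h1 h2 ?_ ?_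
  all_goals
    filter_upwards [eventually_gt_atTop (N : ℝ)] with p hp
    have hp0 : 0 < p := by linarith
  · have h0 : 0 < (p - N) / p := div_pos (by linarith) hp0
    calc ENNReal.ofReal ((p - N) / p) = ENNReal.ofReal (((p - N) / p) ^ p) ^ (1 / p) := by
          rw [ENNReal.ofReal_rpow_of_nonneg (by positivity) (by positivity), ← Real.rpow_mul h0.le,
            mul_one_div_cancel hp0.ne', Real.rpow_one]
      _ ≤ _ := ENNReal.rpow_le_rpow (le_max_right _ _) (by positivity)
  · calc betaConst N p ^ (1 / p) ≤ ENNReal.ofReal p ^ (1 / p) := by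
          refine ENNReal.rpow_le_rpow ((betaConst_le hN hp).trans (ENNReal.ofReal_le_ofReal ?_))
            (by positivity)
          refine mul_le_of_le_one_right hp0.le (Real.rpow_le_one ?_ ?_ (by linarith))
          · exact div_nonneg (by linarith) (by linarith)
          · rw [div_le_one] <;> linarith
      _ = _ := ENNReal.ofReal_rpow_of_nonneg hp0.le (by positivity)

/-- For fixed δ the lower bound has p-th root tending to 1/(1 + 2δ), since the volume factor
disappears in the root. Given b < 1, δ is chosen first with 1/(1 + 2δ) > b, then p is taken large.
From above, the root is at most (N|B_1|)^(1/p). -/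
theorem tendsto_puncturedBallSup_rpow {N : ℕ} (hN : 1 ≤ N) :
    Tendsto (fun p : ℝ => puncturedBallSup N p ^ (1 / p)) atTop (𝓝 1) := by
  have hN' : (1 : ℝ) ≤ N := by exact_mod_cast hN
  refine tendsto_order.2 ⟨fun b hb => ?_, fun b hb => ?_⟩
  · have hlim : Tendsto (fun δ : ℝ => ENNReal.ofReal (1 / (1 + 2 * δ))) (𝓝[>] 0) (𝓝 1) := by
      have hc : ContinuousAt (fun δ : ℝ => ENNReal.ofReal (1 / (1 + 2 * δ))) 0 :=
        ENNReal.continuous_ofReal.continuousAt.comp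
          (continuousAt_const.div (by fun_prop) (by norm_num))
      simpa using hc.tendsto.mono_left (nhdsWithin_le_nhds (s := Set.Ioi 0))
    obtain ⟨δ, hbδ, hδ⟩ :=
      ((hlim.eventually_const_lt hb).and (Ioc_mem_nhdsGT (zero_lt_one' ℝ))).exists
    have hδ0 := hδ.1
    have hV := measureReal_ball_pos (N := N) hδ0
    have h1 : Tendsto (fun p : ℝ => (p - N) / p *
        volume.real (Metric.ball (0 : EuclideanSpace ℝ (Fin N)) δ) ^ (1 / p) / (1 + 2 * δ)) atTop
        (𝓝 (1 * 1 / (1 + 2 * δ))) :=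
      ((tendsto_sub_div_self_atTop N).mul (tendsto_const_rpow_one_div_atTop hV)).div_const _
    rw [one_mul] at h1
    have h2 := (ENNReal.continuous_ofReal.tendsto _).comp h1
    filter_upwards [h2.eventually_const_lt hbδ, eventually_gt_atTop (N : ℝ)] with p hbp hp
    have hp0 : 0 < p := by linarith
    have h0 : 0 < (p - N) / p := div_pos (by linarith) hp0
    refine hbp.trans_le ?_
    calc _ = ENNReal.ofReal (((p - N) / p) ^ p *
          volume.real (Metric.ball (0 : EuclideanSpace ℝ (Fin N)) δ) / (1 + 2 * δ) ^ p) ^ (1 / p) := by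
          rw [ENNReal.ofReal_rpow_of_nonneg (by positivity) (by positivity),
            Real.div_rpow (by positivity) (by positivity), Real.mul_rpow (by positivity) hV.le,
            ← Real.rpow_mul h0.le, ← Real.rpow_mul (by positivity), mul_one_div_cancel hp0.ne',
            Real.rpow_one, Real.rpow_one]
          rfl
      _ ≤ _ := by
          refine ENNReal.rpow_le_rpow (le_trans (ENNReal.ofReal_le_ofReal ?_)
            (ofReal_le_puncturedBallSup hN hp hδ)) (by positivity)
          gcongr
          -- Replacing k by the smaller ((p - N)/p)^p makes the p-th root explicit and loses nothing
          -- in the limit.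
          exact div_rpow_le_mul_rpow hN hp
  · have hV := measureReal_ball_pos (N := N) one_pos
    have hVN : 0 < volume.real (Metric.ball (0 : EuclideanSpace ℝ (Fin N)) 1) * N := by positivity
    have h1 := (ENNReal.continuous_ofReal.tendsto _).comp (tendsto_const_rpow_one_div_atTop hVN)
    rw [ENNReal.ofReal_one] at h1
    filter_upwards [h1.eventually_lt_const hb, eventually_gt_atTop (N : ℝ)] with p hbp hp
    have hp0 : 0 < p := by linarith
    refine lt_of_le_of_lt ?_ hbp
    rw [Function.comp_apply, ← ENNReal.ofReal_rpow_of_nonneg hVN.le (by positivity)]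
    refine ENNReal.rpow_le_rpow ((puncturedBallSup_le hN hp).trans (ENNReal.ofReal_le_ofReal ?_))
      (by positivity)
    rw [← mul_assoc]
    refine mul_le_of_le_one_right hVN.le (Real.rpow_le_one ?_ ?_ (by linarith))
    · exact div_nonneg (by linarith) (by linarith)
    · rw [div_le_one] <;> linarith

theorem mainTheorem2 (N : ℕ) (hN : 1 ≤ N) :
    (∀ p : ℝ, (N : ℝ) < p →
      0 < betaConst N p ∧
      ∀ Ω : Set (EuclideanSpace ℝ (Fin N)), IsOpen Ω → inradius Ω < ⊤ →
        betaConst N p / inradius Ω ^ p ≤ principalFrequency p (ENNReal.ofReal p) Ω ∧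
        puncturedBallSup N p / inradius Ω ^ (p - N) ≤ principalFrequency p ⊤ Ω) ∧
    (0 < liminf (fun p : ℝ => betaConst N p / ENNReal.ofReal ((p - N) ^ (p - 1)))
        (𝓝[>] (N : ℝ)) ∧
      limsup (fun p : ℝ => betaConst N p / ENNReal.ofReal ((p - N) ^ (p - 1)))
        (𝓝[>] (N : ℝ)) < ⊤) ∧
    (0 < liminf (fun p : ℝ => puncturedBallSup N p / ENNReal.ofReal ((p - N) ^ (p - 1)))
        (𝓝[>] (N : ℝ)) ∧
      limsup (fun p : ℝ => puncturedBallSup N p / ENNReal.ofReal ((p - N) ^ (p - 1)))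
        (𝓝[>] (N : ℝ)) < ⊤) ∧
    Tendsto (fun p : ℝ => betaConst N p ^ (1 / p)) atTop (𝓝 1) ∧
    Tendsto (fun p : ℝ => puncturedBallSup N p ^ (1 / p)) atTop (𝓝 1) := by
  refine ⟨fun p hp => ⟨?_, fun Ω _ hΩ => ⟨?_, puncturedBallSup_div_le_principalFrequency hp hΩ⟩⟩,
    betaConst_asymptotics hN, puncturedBallSup_asymptotics hN, tendsto_betaConst_rpow hN,
    tendsto_puncturedBallSup_rpow hN⟩
  · have hp0 : 0 < p := (Nat.cast_nonneg N).trans_lt hp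
    exact lt_max_of_lt_right
      (ENNReal.ofReal_pos.2 (Real.rpow_pos_of_pos (div_pos (sub_pos.2 hp) hp0) _))
  · exact (ENNReal.div_le_div_right (betaConst_le hN hp) _).trans (le_principalFrequency hN hp hΩ)
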